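/- Theorem (prevalent transversal density theorem). Let $r\in\{1,2,\dots\}\cup\{\infty\}$ and let $n,q\geq 0$ be integers. Let $\mathcal{A}$ be an open subset of a real Banach space $E$, let $X$ and $Y$ be $\mathcal{C}^r$-manifolds without boundary, $Y$ modelled on a real Banach space, and let $W\subset Y$ be a $\mathcal{C}^r$-submanifold (not necessarily closed). Let $\rho:\mathcal{A}\to\mathcal{C}^r(X,Y)$, $a\mapsto\rho_a$, be a $\mathcal{C}^r$-representation, that is, the evaluation map $ev_\rho:\mathcal{A}\times X\to Y$, $ev_\rho(a,x)=\rho_a(x)$, is of class $\mathcal{C}^r$. Assume that i) $X$ has finite dimension $n$ and $W$ has finite codimension $q$ in $Y$, ii) $\mathcal{A}$ is separable and $X$ is second countable (for metrizable $X$: separable), iii) $r>\max(0,n-q)$, iv) $ev_\rho$ is transversal to $W$. Then the set $\{a\in\mathcal{A} : \rho_a \text{ is transversal to } W\}$ is generic and prevalent in $\mathcal{A}$. Here a $\mathcal{C}^1$ map $f:M\to Y$ is transversal to $W$ if for every $x\in M$ with $f(x)\in W$, the preimage $(D_xf)^{-1}(T_{f(x)}W)$ is closed and has a closed complement in $T_xM$,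 and the image $D_xf(T_xM)$ contains a closed complement of $T_{f(x)}W$ in $T_{f(x)}Y$. A subset of an open set $U\subset E$ is generic in $U$ if it contains a countable intersection of dense open subsets of $U$, and prevalent in $U$ if its complement in $U$ is contained in a Borel set $S\subset E$ for which there is a finite non-negative Borel measure $\mu\neq 0$ on $E$ with compact support such that $\mu(x+S)=0$ for all $x\in E$. -/

import Mathlib

open Set Filter Topology MeasureTheory
open scoped Manifold ContDiff

/-- `G` is generic (residual) in the open set `U`: it is a subset of `U` that contains a countable
intersection of dense open subsets of `U`. -/
def IsGenericIn {E : Type*} [TopologicalSpace E] (U G : Set E) : Prop :=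
  G ⊆ U ∧ ∃ O : ℕ → Set E,
    (∀ k, IsOpen (O k) ∧ O k ⊆ U ∧ U ⊆ closure (O k)) ∧ (⋂ k, O k) ⊆ G

/-- `B` is Haar-null: it is contained in a Borel set `S` all of whose translates are null for some
finite nonzero Borel measure with compact support. -/
def IsHaarNull {E : Type*} [NormedAddCommGroup E] [MeasurableSpace E] (B : Set E) : Prop :=
  ∃ S : Set E, B ⊆ S ∧ MeasurableSet S ∧
    ∃ μ : Measure E, IsFiniteMeasure μ ∧ μ ≠ 0 ∧ (∃ K : Set E, IsCompact K ∧ μ Kᶜ = 0) ∧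
      ∀ x : E, μ ((fun y => x + y) '' S) = 0

/-- `P` is prevalent in the open set `U`: it is a subset of `U` with Haar-null complement in `U`. -/
def IsPrevalentIn {E : Type*} [NormedAddCommGroup E] [MeasurableSpace E] (U P : Set E) : Prop :=
  P ⊆ U ∧ IsHaarNull (U \ P)

/-- The subspace `P` splits: it is closed and admits a closed complement. -/
def SubspaceSplits {V : Type*} [AddCommGroup V] [Module ℝ V] [TopologicalSpace V]
    (P : Submodule ℝ V) : Prop :=
  IsClosed (P : Set V) ∧ ∃ C : Submodule ℝ V, IsClosed (C : Set V) ∧ IsCompl P C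

section Submanifold

variable {F : Type*} [NormedAddCommGroup F] [NormedSpace ℝ F]
  {Y : Type*} [TopologicalSpace Y] [ChartedSpace F Y]

/-- `W` is a (not necessarily closed) `C^r` submanifold of `Y` of codimension `q`: around each of
its points some chart `φ` of the `C^r` structure of `Y` flattens it, that is,
`φ (W ∩ source) = G ∩ target` for a split subspace `G` of codimension `q` of the model space. -/
def IsSubmanifoldOfCodim (r : WithTop ℕ∞) (q : ℕ) (W : Set Y) : Prop :=
  ∀ w ∈ W, ∃ φ ∈ IsManifold.maximalAtlas 𝓘(ℝ, F) r Y, w ∈ φ.source ∧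
    ∃ G : Submodule ℝ F, SubspaceSplits G ∧ Module.Finite ℝ (F ⧸ G) ∧ Module.finrank ℝ (F ⧸ G) = q ∧
      φ.IsImage W (G : Set F)

/-- The tangent space `T_w W` of a submanifold `W` of `Y` at `w ∈ W`, as a subspace of `T_w Y`:
the velocities at `w` of curves in `W`. (They form a subspace when `W` is a submanifold, so that
taking the span adds nothing.) -/
noncomputable def tangentSpaceOf (W : Set Y) (w : Y) : Submodule ℝ (TangentSpace 𝓘(ℝ, F) w) :=
  Submodule.span ℝ {v : F | ∃ γ : ℝ → Y, γ 0 = w ∧ (∀ᶠ t in 𝓝 (0 : ℝ), γ t ∈ W) ∧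
    HasMFDerivAt 𝓘(ℝ, ℝ) 𝓘(ℝ, F) γ 0 ((1 : ℝ →L[ℝ] ℝ).smulRight v)}

variable {E : Type*} [NormedAddCommGroup E] [NormedSpace ℝ E] {H : Type*} [TopologicalSpace H]
  (I : ModelWithCorners ℝ E H) {M : Type*} [TopologicalSpace M] [ChartedSpace H M]

/-- The `C^1` map `f : M → Y` is transversal to the submanifold `W` of `Y`: whenever `f x ∈ W`,
the preimage of `T_{f x} W` under `D_x f` splits in `T_x M`, and the image of `D_x f` contains a
closed complement of `T_{f x} W` in `T_{f x} Y`. -/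
def IsTransversalTo (f : M → Y) (W : Set Y) : Prop :=
  ContMDiff I 𝓘(ℝ, F) 1 f ∧ ∀ x : M, f x ∈ W →
    SubspaceSplits ((tangentSpaceOf (F := F) W (f x)).comap (mfderiv I 𝓘(ℝ, F) f x).toLinearMap) ∧
    ∃ C : Submodule ℝ (TangentSpace 𝓘(ℝ, F) (f x)),
      IsClosed (C : Set (TangentSpace 𝓘(ℝ, F) (f x))) ∧
      C ≤ (mfderiv I 𝓘(ℝ, F) f x).toLinearMap.range ∧
      IsCompl (tangentSpaceOf (F := F) W (f x)) C

end Submanifold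

section Representation

variable {E₁ : Type*} [NormedAddCommGroup E₁] [NormedSpace ℝ E₁]
  {H₁ : Type*} [TopologicalSpace H₁] {I₁ : ModelWithCorners ℝ E₁ H₁}
  {E₂ : Type*} [NormedAddCommGroup E₂] [NormedSpace ℝ E₂]
  {H₂ : Type*} [TopologicalSpace H₂] {I₂ : ModelWithCorners ℝ E₂ H₂}
  {E₃ : Type*} [NormedAddCommGroup E₃] [NormedSpace ℝ E₃]
  {H₃ : Type*} [TopologicalSpace H₃] {I₃ : ModelWithCorners ℝ E₃ H₃}
  {A : Type*} [TopologicalSpace A] [ChartedSpace H₁ A]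
  {X : Type*} [TopologicalSpace X] [ChartedSpace H₂ X]
  {Y : Type*} [TopologicalSpace Y] [ChartedSpace H₃ Y]
  {r : WithTop ℕ∞}

/-- The evaluation map `(a, x) ↦ ρ_a(x)` of a family `ρ` of `C^r` maps. -/
noncomputable def evalMap (ρ : A → C^r⟮I₂, X; I₃, Y⟯) : A × X → Y := fun p => ρ p.1 p.2

variable (I₁) in
/-- `ρ` is a `C^r` representation: its evaluation map is of class `C^r` on `A × X`. -/
def IsCrRepresentation (ρ : A → C^r⟮I₂, X; I₃, Y⟯) : Prop :=
  ContMDiff (I₁.prod I₂) I₃ r (evalMap ρ)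

end Representation

open Module (finrank)
open scoped NNReal ENNReal

/-! ### Images of flat sets -/

/-! Near a point of `W`, a flattening chart followed by a quotient map presents `W` as the zero set
of a submersion to ℝ^q. In coordinates the evaluation map becomes a C^k map g on E × EX, with k
finite, k ≤ r and n < k + q. Transversality says that Dg is onto at zeros of g, and a parameter a is
bad when ∂ₓg is not onto at some zero (a, x).

As q is finite, finitely many vectors w_0, …, w_{m-1} of a sequence with dense span already keep Dg
onto on their span times EX, throughout a neighbourhood. Compactness in x makes the local bad set S
closed. For each e, the s ∈ ℝ^m with e + ∑ s_i w_i ∈ S form a null set, by a finite-dimensional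
parametric Sard theorem (`measure_setOf_not_surjective_eq_zero`). Countably many such S contain all
bad parameters. Each has dense complement, whence genericity. For prevalence a single measure serves
every S: the law of ∑ t_i w_i with t_i independent and uniform on [0,1], where ∑ ‖w_i‖ < ∞; fixing
the t_i with i ≥ m leaves a null slice (`isHaarNull_of_null_slices`).

For the parametric Sard theorem, stratify the bad zeros by the rank ρ of ∂ₓg. Locally the zero set
is parametrized by T₁ × C, where C = ker ∂ₓg has dimension n - ρ and T₁ has codimension q - ρ in
parameter space. At zeros of the same rank, moving along C does not move the parameter to first
order. Hence each slice parallel to a complement T₂ of T₁ lies in the image of points where a map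
from C to T₂ has zero derivative. Such an image is null by Morse's theorem
(`volume_image_setOf_fderiv_eq_zero`), since dim C ≤ k dim T₂, and Fubini concludes. -/

theorem volume_image_le_of_forall_norm_sub_le {d s k : ℕ} (hk : 0 < k) (hds : d ≤ k * s)
    {h : (Fin d → ℝ) → (Fin s → ℝ)} {S M : Set (Fin d → ℝ)} (hM : MeasurableSet M) (hSM : S ⊆ M)
    {ε : ℝ≥0} {δ : ℝ} (hδ : 0 < δ)
    (H : ∀ x ∈ S, ∀ y, dist y x < δ → ‖h y - h x‖ ≤ ε * ‖y - x‖ ^ k) :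
    volume (h '' S) ≤ (ε : ℝ≥0∞) ^ (s : ℝ) * volume M := by
  let u := TopologicalSpace.denseSeq (Fin d → ℝ)
  let P := disjointed fun i => Metric.ball (u i) (δ / 2)
  have hPm : ∀ i, MeasurableSet (P i) :=
    MeasurableSet.disjointed fun i => measurableSet_ball
  have hPd : Pairwise (Function.onFun Disjoint P) := disjoint_disjointed _
  have hPU : ⋃ i, P i = univ := by
    rw [iUnion_disjointed, eq_univ_iff_forall]
    intro x
    obtain ⟨i, hi⟩ := (TopologicalSpace.denseRange_denseSeq (Fin d → ℝ)).exists_dist_lt x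
      (half_pos hδ)
    exact mem_iUnion.2 ⟨i, hi⟩
  have hpiece : ∀ i, volume (h '' (S ∩ P i)) ≤ (ε : ℝ≥0∞) ^ (s : ℝ) * volume (M ∩ P i) := by
    intro i
    -- On pieces of diameter below `δ` the hypothesis is a Hölder condition of exponent `k`. It
    -- bounds s-dimensional Hausdorff measure of the image by ks-dimensional measure of the source,
    -- and `d ≤ k * s`.
    have hol : HolderOnWith ε k h (S ∩ P i) := by
      intro x hx y hy
      have hx' : dist x (u i) < δ / 2 := disjointed_subset (fun i => Metric.ball (u i) (δ / 2)) i hx.2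
      have hy' : dist y (u i) < δ / 2 := disjointed_subset (fun i => Metric.ball (u i) (δ / 2)) i hy.2
      have hxy : dist x y < δ := by
        have := dist_triangle_right x y (u i)
        linarith
      have := H y hy.1 x hxy
      rw [← dist_eq_norm, ← dist_eq_norm] at this
      rw [edist_nndist, edist_nndist]
      have h2 : nndist (h x) (h y) ≤ ε * nndist x y ^ k := by exact_mod_cast this
      calc (nndist (h x) (h y) : ℝ≥0∞) ≤ ((ε * nndist x y ^ k : ℝ≥0) : ℝ≥0∞) := by
            exact_mod_cast h2
        _ = _ := by push_cast; simp
    have h1 := hol.hausdorffMeasure_image_le (by exact_mod_cast hk) (d := (s : ℝ)) (by positivity)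
    have e1 : (volume : Measure (Fin s → ℝ)) = μH[(s : ℝ)] := by
      simpa using (hausdorffMeasure_pi_real (ι := Fin s)).symm
    have e2 : (volume : Measure (Fin d → ℝ)) = μH[(d : ℝ)] := by
      simpa using (hausdorffMeasure_pi_real (ι := Fin d)).symm
    rw [e1, e2]
    refine h1.trans ?_
    refine mul_le_mul' le_rfl ?_
    refine (Measure.hausdorffMeasure_mono (X := Fin d → ℝ) (d₁ := (d : ℝ))
      (d₂ := ((k : ℝ≥0) : ℝ) * s) (by push_cast; exact_mod_cast hds) _).trans ?_
    exact measure_mono (inter_subset_inter_left _ hSM)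
  have hcov : h '' S ⊆ ⋃ i, h '' (S ∩ P i) := by
    rw [← image_iUnion, ← inter_iUnion, hPU, inter_univ]
  calc volume (h '' S) ≤ ∑' i, volume (h '' (S ∩ P i)) :=
        (measure_mono hcov).trans (measure_iUnion_le _)
    _ ≤ ∑' i, (ε : ℝ≥0∞) ^ (s : ℝ) * volume (M ∩ P i) := ENNReal.tsum_le_tsum hpiece
    _ = (ε : ℝ≥0∞) ^ (s : ℝ) * ∑' i, volume (M ∩ P i) := ENNReal.tsum_mul_left
    _ = (ε : ℝ≥0∞) ^ (s : ℝ) * volume M := by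
        rw [← measure_iUnion (fun i j hij => (hPd hij).mono inter_subset_right inter_subset_right)
          (fun i => hM.inter (hPm i)), ← inter_iUnion, hPU, inter_univ]

/-- Let ε tend to 0 in the previous bound. The points where the ε-estimate holds at scale 1/(j+1)
increase with j to all of `B ∩ M`, and outer measure is continuous along increasing unions, so `B`
need not be measurable. -/
theorem volume_image_eq_zero_of_isLittleO {d s k : ℕ} (hk : 0 < k) (hs : 0 < s) (hds : d ≤ k * s)
    {h : (Fin d → ℝ) → (Fin s → ℝ)} {B : Set (Fin d → ℝ)}
    (H : ∀ x ∈ B, (fun y => h y - h x) =o[𝓝 x] fun y => ‖y - x‖ ^ k) :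
    volume (h '' B) = 0 := by
  have hball : ∀ R : ℕ, volume (h '' (B ∩ Metric.closedBall 0 R)) = 0 := by
    intro R
    set M : Set (Fin d → ℝ) := Metric.closedBall 0 R
    have hMfin : volume M ≠ ⊤ := (isCompact_closedBall _ _).measure_lt_top.ne
    have key : ∀ ε : ℝ≥0, 0 < ε → volume (h '' (B ∩ M)) ≤ (ε : ℝ≥0∞) ^ (s : ℝ) * volume M := by
      intro ε hε
      let S : ℕ → Set (Fin d → ℝ) := fun j =>
        {x ∈ B ∩ M | ∀ y, dist y x < 1 / ((j : ℝ) + 1) → ‖h y - h x‖ ≤ ε * ‖y - x‖ ^ k}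
      have hmono : Monotone S := fun i j hij x hx =>
        ⟨hx.1, fun y hy => hx.2 y (hy.trans_le (Nat.one_div_le_one_div hij))⟩
      have hU : B ∩ M ⊆ ⋃ j, S j := by
        intro x hx
        have := (H x hx.1).def (show (0 : ℝ) < ε from hε)
        obtain ⟨δ, hδ, hb⟩ := Metric.eventually_nhds_iff.1 this
        obtain ⟨j, hj⟩ := exists_nat_one_div_lt hδ
        refine mem_iUnion.2 ⟨j, hx, fun y hy => ?_⟩
        simpa using hb (hy.trans hj)
      calc volume (h '' (B ∩ M)) ≤ volume (⋃ j, h '' S j) := by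
            rw [← image_iUnion]
            exact measure_mono (image_mono hU)
        _ = ⨆ j, volume (h '' S j) :=
            Monotone.measure_iUnion fun i j hij => image_mono (hmono hij)
        _ ≤ _ := iSup_le fun j => volume_image_le_of_forall_norm_sub_le hk hds
            measurableSet_closedBall (fun x hx => hx.1.2) Nat.one_div_pos_of_nat
            fun x hx y hy => hx.2 y hy
    have hlim : Tendsto (fun ε : ℝ≥0 => (ε : ℝ≥0∞) ^ (s : ℝ) * volume M) (𝓝[>] 0) (𝓝 0) := by
      have h1 : Tendsto (fun ε : ℝ≥0 => (ε : ℝ≥0∞) ^ (s : ℝ)) (𝓝 0) (𝓝 0) := by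
        have : Continuous fun ε : ℝ≥0 => (ε : ℝ≥0∞) ^ (s : ℝ) :=
          (ENNReal.continuous_rpow_const).comp ENNReal.continuous_coe
        have h3 := this.tendsto 0
        rwa [ENNReal.coe_zero, ENNReal.zero_rpow_of_pos (by exact_mod_cast hs)] at h3
      have h2 := ENNReal.Tendsto.mul_const (b := volume M) h1 (Or.inr hMfin)
      rw [zero_mul] at h2
      exact h2.mono_left nhdsWithin_le_nhds
    exact le_antisymm (ge_of_tendsto hlim (eventually_mem_nhdsWithin.mono key)) zero_le
  have hcov : h '' B ⊆ ⋃ R : ℕ, h '' (B ∩ Metric.closedBall 0 R) := by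
    rw [← image_iUnion, ← inter_iUnion, Metric.iUnion_closedBall_nat, inter_univ]
  exact measure_mono_null hcov (measure_iUnion_null hball)

/-! ### Local parametrizations -/

/-- Taking all of ℝ^d as the parameter domain keeps later parametrizations globally defined, so no
domains have to be carried through the induction. -/
theorem exists_contDiff_range_mem_nhds {V : Type*} [NormedAddCommGroup V] [NormedSpace ℝ V]
    [FiniteDimensional ℝ V] {d : ℕ} (hd : finrank ℝ V = d) {x : V} {U : Set V} (hU : U ∈ 𝓝 x) :
    ∃ u : (Fin d → ℝ) → V, ContDiff ℝ ∞ u ∧ range u ⊆ U ∧ range u ∈ 𝓝 x := by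
  let e : EuclideanSpace ℝ (Fin d) ≃L[ℝ] V :=
    ContinuousLinearEquiv.ofFinrankEq (by simp [hd])
  let e' : (Fin d → ℝ) ≃L[ℝ] EuclideanSpace ℝ (Fin d) := (EuclideanSpace.equiv (Fin d) ℝ).symm
  have hU' : e ⁻¹' U ∈ 𝓝 (e.symm x) := by
    apply e.continuous.continuousAt.preimage_mem_nhds
    simpa using hU
  obtain ⟨r, hr, hb⟩ := Metric.mem_nhds_iff.1 hU'
  let b := OpenPartialHomeomorph.univBall (E := EuclideanSpace ℝ (Fin d)) (e.symm x) r
  have hrange : range (fun y => e (b (e' y))) = e '' Metric.ball (e.symm x) r := by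
    have h1 : range b = Metric.ball (e.symm x) r := by
      rw [← image_univ, ← OpenPartialHomeomorph.univBall_source (e.symm x) r,
        b.image_source_eq_target, OpenPartialHomeomorph.univBall_target _ hr]
    rw [← h1, ← range_comp]
    exact (e'.surjective.range_comp (e ∘ b))
  refine ⟨fun y => e (b (e' y)), ?_, ?_, ?_⟩
  · exact e.contDiff.comp (OpenPartialHomeomorph.contDiff_univBall.comp e'.contDiff)
  · rw [hrange]
    exact image_subset_iff.2 hb
  · rw [hrange]
    have := e.toHomeomorph.isOpenMap.image_mem_nhds (Metric.ball_mem_nhds (e.symm x) hr)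
    simpa using this

theorem exists_contDiff_param_zeroSet {m k : ℕ} {g : (Fin (m + 1) → ℝ) → ℝ}
    (hg : ContDiff ℝ (k + 1 : ℕ) g) {x : Fin (m + 1) → ℝ} (hx : g x = 0) (hx' : fderiv ℝ g x ≠ 0) :
    ∃ ψ : (Fin m → ℝ) → (Fin (m + 1) → ℝ), ContDiff ℝ (k + 1 : ℕ) ψ ∧
      ∃ U ∈ 𝓝 x, {y | g y = 0} ∩ U ⊆ range ψ := by
  have hk0 : ((k + 1 : ℕ) : WithTop ℕ∞) ≠ 0 := by exact_mod_cast Nat.succ_ne_zero k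
  have hstrict : HasStrictFDerivAt g (fderiv ℝ g x) x := hg.contDiffAt.hasStrictFDerivAt hk0
  have hsurj : (fderiv ℝ g x : (Fin (m + 1) → ℝ) →ₗ[ℝ] ℝ).range = ⊤ :=
    LinearMap.range_eq_top.2 (LinearMap.surjective fun h => hx' (by ext v; exact DFunLike.congr_fun h _))
  let D := hstrict.implicitFunctionDataOfComplemented g (fderiv ℝ g x) hsurj
    (Submodule.ClosedComplemented.of_finiteDimensional _)
  have hl : ContDiffAt ℝ (k + 1 : ℕ) D.leftFun D.pt := hg.contDiffAt
  have hrc : ContDiff ℝ (k + 1 : ℕ) D.rightFun :=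
    (ContinuousLinearMap.contDiff _).comp (contDiff_id.sub contDiff_const)
  have himp := D.contDiffAt_implicitFunction hl hrc.contDiffAt hk0
  have hleft : D.leftFun D.pt = 0 := hx
  obtain ⟨U, hU, hUc⟩ := himp.contDiffOn (m := (k + 1 : ℕ)) le_rfl (by simp)
  have hUz : {z | ((0 : ℝ), z) ∈ U} ∈ 𝓝 (D.rightFun D.pt) := by
    have : Continuous fun z : (fderiv ℝ g x : (Fin (m + 1) → ℝ) →ₗ[ℝ] ℝ).ker => ((0 : ℝ), z) := by fun_prop
    apply this.continuousAt.preimage_mem_nhds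
    rwa [show ((0 : ℝ), D.rightFun D.pt) = D.prodFun D.pt from Prod.ext hleft.symm rfl]
  have hd : finrank ℝ (fderiv ℝ g x : (Fin (m + 1) → ℝ) →ₗ[ℝ] ℝ).ker = m := by
    have := LinearMap.finrank_range_add_finrank_ker (fderiv ℝ g x : (Fin (m + 1) → ℝ) →ₗ[ℝ] ℝ)
    rw [hsurj] at this
    simp at this
    omega
  obtain ⟨V, hVU, hVo, hVx⟩ := mem_nhds_iff.1 hUz
  obtain ⟨u, hu, huU, hun⟩ := exists_contDiff_range_mem_nhds hd (hVo.mem_nhds hVx)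
  refine ⟨fun y => D.implicitFunction 0 (u y), ?_, ?_⟩
  · have : ContDiffOn ℝ (k + 1 : ℕ) (fun y => D.implicitFunction.uncurry (0, u y)) univ :=
      hUc.comp (contDiff_const.prodMk (hu.of_le (by exact_mod_cast le_top))).contDiffOn
        (fun y _ => hVU (huU (mem_range_self y)))
    exact contDiffOn_univ.1 this
  · refine ⟨{y | D.implicitFunction (D.leftFun y) (D.rightFun y) = y ∧ D.rightFun y ∈ range u},
      ?_, ?_⟩
    · refine Filter.Eventually.and (D.implicitFunction_apply_image) ?_
      exact hrc.continuous.continuousAt.preimage_mem_nhds hun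
    · rintro y ⟨hy, hy1, z, hz⟩
      refine ⟨z, ?_⟩
      have : D.leftFun y = 0 := hy
      simp only [hz]
      rwa [this] at hy1

/-! ### Flat pieces -/

theorem isLittleO_of_apply_single {α G : Type*} [NormedAddCommGroup G] [NormedSpace ℝ G] {m : ℕ}
    {l : Filter α} {L : α → (Fin m → ℝ) →L[ℝ] G} {b : α → ℝ}
    (h : ∀ i, (fun y => L y (Pi.single i 1)) =o[l] b) : L =o[l] b := by
  let P : Fin m → G →L[ℝ] (Fin m → ℝ) →L[ℝ] G := fun i =>
    ContinuousLinearMap.smulRightL ℝ (Fin m → ℝ) G (ContinuousLinearMap.proj i)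
  have hL : L = ∑ i, fun y => P i (L y (Pi.single i 1)) := by
    funext y
    rw [Finset.sum_apply]
    ext v
    conv_lhs => rw [pi_eq_sum_univ' v]
    simp [P]
  rw [hL]
  have hP : ∀ i ∈ Finset.univ, (fun y => P i (L y (Pi.single i 1))) =o[l] b := fun i _ =>
    ((P i).isBigO_comp (fun y => L y (Pi.single i 1)) l).trans_isLittleO (h i)
  exact Asymptotics.IsLittleO.sum hP

/-- The mean value inequality for `f ∘ ψ` on balls gains one order. The derivative of `f` need be
small only along `ψ`, because that of `ψ` is locally bounded. -/
theorem isLittleO_comp_sub_of_fderiv {V V' G : Type*} [NormedAddCommGroup V] [NormedSpace ℝ V]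
    [NormedAddCommGroup V'] [NormedSpace ℝ V'] [NormedAddCommGroup G] [NormedSpace ℝ G]
    {f : V → G} {ψ : V' → V} (hf : Differentiable ℝ f) (hψ : ContDiff ℝ 1 ψ) {x : V'} {k : ℕ}
    (h : (fun y => fderiv ℝ f (ψ y)) =o[𝓝 x] fun y => ‖y - x‖ ^ k) :
    (fun y => f (ψ y) - f (ψ x)) =o[𝓝 x] fun y => ‖y - x‖ ^ (k + 1) := by
  have hψd : Differentiable ℝ ψ := hψ.differentiable one_ne_zero
  have hF : ∀ y, fderiv ℝ (f ∘ ψ) y = (fderiv ℝ f (ψ y)).comp (fderiv ℝ ψ y) := fun y =>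
    fderiv_comp y (hf _) (hψd _)
  have hbdd : (fun y => fderiv ℝ ψ y) =O[𝓝 x] fun _ => (1 : ℝ) :=
    (hψ.continuous_fderiv one_ne_zero).continuousAt.isBigO_one ℝ
  have hFo : (fun y => fderiv ℝ (f ∘ ψ) y) =o[𝓝 x] fun y => ‖y - x‖ ^ k := by
    have h1 : (fun y => fderiv ℝ (f ∘ ψ) y) =O[𝓝 x]
        fun y => ‖fderiv ℝ f (ψ y)‖ * ‖fderiv ℝ ψ y‖ := by
      refine Asymptotics.IsBigO.of_bound 1 (Eventually.of_forall fun y => ?_)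
      rw [hF, one_mul, norm_mul, norm_norm, norm_norm]
      exact ContinuousLinearMap.opNorm_comp_le _ _
    have h2 := h.norm_left.mul_isBigO hbdd.norm_left
    simp only [mul_one] at h2
    exact h1.trans_isLittleO h2
  refine Asymptotics.IsLittleO.of_bound fun ε hε => ?_
  obtain ⟨δ, hδ, hb⟩ := Metric.eventually_nhds_iff.1 (hFo.def hε)
  refine Metric.eventually_nhds_iff.2 ⟨δ, hδ, fun y hy => ?_⟩
  have hmv := (convex_closedBall x ‖y - x‖).norm_image_sub_le_of_norm_fderiv_le (𝕜 := ℝ)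
    (f := f ∘ ψ) (C := ε * ‖y - x‖ ^ k) (x := x) (y := y)
    (fun z _ => (hf _).comp z (hψd z)) (fun z hz => ?_) (by simp) (by simp [dist_eq_norm])
  · rw [norm_pow, norm_norm, pow_succ, ← mul_assoc]
    exact hmv
  · rw [Metric.mem_closedBall, dist_eq_norm] at hz
    have hz' : dist z x < δ := by
      rw [dist_eq_norm] at hy ⊢
      exact hz.trans_lt hy
    refine (hb hz').trans ?_
    rw [norm_pow, norm_norm]
    gcongr

/-- `B` is a part of `A`, parametrized by a `C¹` map `ψ` in such a way that every `C^k` function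
which vanishes on `A` pulls back to a function that is flat to order `k` at the parameters
of `B`. -/
def FlatPiece (k : ℕ) {m : ℕ} (A B : Set (Fin m → ℝ)) : Prop :=
  B ⊆ A ∧ ∃ d ≤ m, ∃ (ψ : (Fin d → ℝ) → (Fin m → ℝ)) (B' : Set (Fin d → ℝ)),
    ContDiff ℝ 1 ψ ∧ B = ψ '' B' ∧
    ∀ g : (Fin m → ℝ) → ℝ, ContDiff ℝ k g → (∀ x ∈ A, g x = 0) →
      ∀ x ∈ B', (fun y => g (ψ y)) =o[𝓝 x] fun y => ‖y - x‖ ^ k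

/-- `S` is covered by countably many flat pieces of `A`. -/
def CoveredByFlatPieces (k : ℕ) {m : ℕ} (A S : Set (Fin m → ℝ)) : Prop :=
  ∃ 𝒞 : Set (Set (Fin m → ℝ)), 𝒞.Countable ∧ S ⊆ ⋃₀ 𝒞 ∧ ∀ B ∈ 𝒞, FlatPiece k A B

namespace CoveredByFlatPieces

variable {k m : ℕ} {A S T : Set (Fin m → ℝ)}

theorem union (hS : CoveredByFlatPieces k A S) (hT : CoveredByFlatPieces k A T) :
    CoveredByFlatPieces k A (S ∪ T) := by
  obtain ⟨C, hC, hSC, hCp⟩ := hS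
  obtain ⟨D, hD, hTD, hDp⟩ := hT
  refine ⟨C ∪ D, hC.union hD, ?_, ?_⟩
  · rw [sUnion_union]
    exact union_subset_union hSC hTD
  · rintro B (hB | hB)
    exacts [hCp B hB, hDp B hB]

theorem of_locally (h : ∀ x ∈ S, ∃ U ∈ 𝓝 x, CoveredByFlatPieces k A (S ∩ U)) :
    CoveredByFlatPieces k A S := by
  choose! U hU C hC hSC hCp using h
  obtain ⟨t, hts, htc, hcov⟩ := TopologicalSpace.countable_cover_nhdsWithin
    fun x hx => mem_nhdsWithin_of_mem_nhds (hU x hx)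
  refine ⟨⋃ x ∈ t, C x, htc.biUnion fun x hx => hC x (hts hx), fun y hy => ?_, fun B hB => ?_⟩
  · obtain ⟨x, hx, hyx⟩ := mem_iUnion₂.1 (hcov hy)
    obtain ⟨B, hB, hyB⟩ := hSC x (hts hx) ⟨hy, hyx⟩
    exact ⟨B, mem_iUnion₂.2 ⟨x, hx, hB⟩, hyB⟩
  · obtain ⟨x, hx, hBx⟩ := mem_iUnion₂.1 hB
    exact hCp x (hts hx) B hBx

end CoveredByFlatPieces

theorem FlatPiece.image {k m n : ℕ} (hmn : m ≤ n) {A : Set (Fin n → ℝ)}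
    {ψ : (Fin m → ℝ) → (Fin n → ℝ)} (hψ : ContDiff ℝ (k + 1 : ℕ) ψ) {B : Set (Fin m → ℝ)}
    (hB : FlatPiece (k + 1) (ψ ⁻¹' A) B) : FlatPiece (k + 1) A (ψ '' B) := by
  obtain ⟨hBA, d, hd, θ, B', hθ, rfl, hflat⟩ := hB
  refine ⟨image_subset_iff.2 hBA, d, hd.trans hmn, ψ ∘ θ, B',
    (hψ.of_le (by norm_cast; omega)).comp hθ, (image_comp _ _ _).symm, fun g hg hgA => ?_⟩
  exact hflat (g ∘ ψ) (hg.comp hψ) fun x hx => hgA _ hx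

/-- The partial derivatives of a function vanishing on `A` are C^k and vanish on `A'`, hence are
flat to order `k` on the piece; integration gains the missing order. -/
theorem FlatPiece.succ {k m : ℕ} {A A' B : Set (Fin m → ℝ)} (hA' : A' ⊆ A)
    (hcrit : ∀ g : (Fin m → ℝ) → ℝ, ContDiff ℝ (k + 1 : ℕ) g → (∀ x ∈ A, g x = 0) →
      ∀ x ∈ A', fderiv ℝ g x = 0)
    (hB : FlatPiece k A' B) : FlatPiece (k + 1) A B := by
  obtain ⟨hBA, d, hd, ψ, B', hψ, rfl, hflat⟩ := hB
  refine ⟨hBA.trans hA', d, hd, ψ, B', hψ, rfl, fun g hg hgA x hx => ?_⟩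
  have hfd : (fun y => fderiv ℝ g (ψ y)) =o[𝓝 x] fun y => ‖y - x‖ ^ k := by
    refine isLittleO_of_apply_single fun i => ?_
    refine hflat (fun z => fderiv ℝ g z (Pi.single i 1)) ?_ (fun z hz => ?_) x hx
    · exact (hg.fderiv_right (m := k) (by norm_cast)).clm_apply contDiff_const
    · rw [hcrit g hg hgA z hz, zero_apply]
  have := isLittleO_comp_sub_of_fderiv
    (hg.differentiable (by exact_mod_cast Nat.succ_ne_zero k)) hψ hfd
  simpa [hgA (ψ x) (hA' (hBA (mem_image_of_mem ψ hx)))] using this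

/-- Morse's decomposition, by induction on `k` and, within it, on the dimension. Where every
admissible function has zero derivative, `k` can be lowered. Elsewhere `A` lies locally in a C^{k+1}
hypersurface, which lowers the dimension. -/
theorem coveredByFlatPieces_self (k : ℕ) : ∀ {m : ℕ} (A : Set (Fin m → ℝ)),
    CoveredByFlatPieces k A A := by
  induction k with
  | zero =>
    intro m A
    refine ⟨{A}, countable_singleton _, by simp, ?_⟩
    rintro B rfl
    refine ⟨Subset.rfl, m, le_rfl, id, B, contDiff_id, (image_id _).symm, fun g hg hgA x hx => ?_⟩
    simp only [pow_zero, id]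
    rw [Asymptotics.isLittleO_one_iff]
    have := hg.continuous.tendsto x
    rwa [hgA x hx] at this
  | succ k ihk =>
    intro m
    induction m with
    | zero =>
      intro A
      refine ⟨{A}, countable_singleton _, by simp, ?_⟩
      rintro B rfl
      refine ⟨Subset.rfl, 0, le_rfl, id, B, contDiff_id, (image_id _).symm,
        fun g hg hgA x hx => ?_⟩
      refine Asymptotics.IsLittleO.of_bound fun c hc => Eventually.of_forall fun y => ?_
      rw [Subsingleton.elim y x, id, hgA x hx, norm_zero]
      positivity
    | succ m ihm =>
      intro A
      let R : Set (Fin (m + 1) → ℝ) := {x ∈ A | ∀ g : (Fin (m + 1) → ℝ) → ℝ,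
        ContDiff ℝ (k + 1 : ℕ) g → (∀ y ∈ A, g y = 0) → fderiv ℝ g x = 0}
      have hR : CoveredByFlatPieces (k + 1) A R := by
        obtain ⟨C, hC, hRC, hCp⟩ := ihk R
        exact ⟨C, hC, hRC, fun B hB => (hCp B hB).succ (A' := R) (sep_subset _ _)
          fun g hg hgA x hx => hx.2 g hg hgA⟩
      have hN : CoveredByFlatPieces (k + 1) A (A \ R) := by
        refine CoveredByFlatPieces.of_locally fun x hx => ?_
        have : ∃ g : (Fin (m + 1) → ℝ) → ℝ,
            ContDiff ℝ (k + 1 : ℕ) g ∧ (∀ y ∈ A, g y = 0) ∧ fderiv ℝ g x ≠ 0 := by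
          by_contra! hcon
          exact hx.2 ⟨hx.1, hcon⟩
        obtain ⟨g, hg, hgA, hgx⟩ := this
        obtain ⟨ψ, hψ, U, hU, hUψ⟩ := exists_contDiff_param_zeroSet hg (hgA x hx.1) hgx
        obtain ⟨C, hC, hRC, hCp⟩ := ihm (ψ ⁻¹' A)
        refine ⟨U, hU, (fun B => ψ '' B) '' C, hC.image _, ?_, ?_⟩
        · rintro y ⟨⟨hyA, -⟩, hyU⟩
          obtain ⟨z, rfl⟩ := hUψ ⟨hgA y hyA, hyU⟩
          obtain ⟨B, hB, hzB⟩ := hRC hyA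
          exact ⟨_, mem_image_of_mem _ hB, mem_image_of_mem _ hzB⟩
        · rintro _ ⟨B, hB, rfl⟩
          exact (hCp B hB).image (Nat.le_succ m) hψ
      have := hN.union hR
      rwa [sdiff_union_of_subset (sep_subset _ _)] at this

/-- The rank zero case of the sharp Morse–Sard theorem. -/
theorem volume_image_setOf_fderiv_eq_zero {m s k : ℕ} (hk : 0 < k) (hs : 0 < s) (hms : m ≤ k * s)
    {f : (Fin m → ℝ) → (Fin s → ℝ)} (hf : ContDiff ℝ k f) :
    volume (f '' {x | fderiv ℝ f x = 0}) = 0 := by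
  obtain ⟨k, rfl⟩ := Nat.exists_eq_succ_of_ne_zero hk.ne'
  -- From here `k` is the smoothness of `f` minus one. The partial derivatives are C^k and vanish on
  -- the critical set, so on each piece `f` is flat to the full order `k + 1`.
  obtain ⟨C, hC, hAC, hCp⟩ := coveredByFlatPieces_self k {x | fderiv ℝ f x = 0}
  refine measure_mono_null (image_mono hAC) ?_
  rw [sUnion_eq_biUnion, image_iUnion₂, measure_biUnion_null_iff hC]
  intro B hB
  obtain ⟨hBA, d, hd, ψ, B', hψ, rfl, hflat⟩ := hCp B hB
  rw [← image_comp]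
  refine volume_image_eq_zero_of_isLittleO hk hs (hd.trans hms) fun x hx => ?_
  refine isLittleO_comp_sub_of_fderiv
    (hf.differentiable (by exact_mod_cast hk.ne')) hψ ?_
  refine isLittleO_of_apply_single fun i => Asymptotics.isLittleO_pi.2 fun j => ?_
  refine hflat (fun z => fderiv ℝ f z (Pi.single i 1) j) ?_ (fun z hz => ?_) x hx
  · have h1 : ContDiff ℝ k fun z => fderiv ℝ f z (Pi.single i 1) :=
      (hf.fderiv_right (m := k) (by norm_cast)).clm_apply contDiff_const
    exact contDiff_pi.1 h1 j
  · have : fderiv ℝ f z = 0 := hz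
    rw [this]
    rfl

/-! ### Parametrized singular sets -/

section Splitting

variable {P X Q : Type*} [AddCommGroup P] [Module ℝ P] [AddCommGroup X] [Module ℝ X]
  [AddCommGroup Q] [Module ℝ Q]

/-- `T₁` holds the parameter directions whose effect on `Q` can be undone by moving in `X`. A
complement `T₂` supplies exactly what the range of D(0, ·) misses, so `D` maps `T₂ × N`
isomorphically onto `Q`. -/
theorem exists_isCompl_ker_prod [FiniteDimensional ℝ P] [FiniteDimensional ℝ X]
    [FiniteDimensional ℝ Q] {D : P × X →ₗ[ℝ] Q} (hD : D.range = ⊤) {N : Submodule ℝ X}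
    (hN : IsCompl (D ∘ₗ LinearMap.inr ℝ P X).ker N) :
    ∃ T₁ T₂ : Submodule ℝ P, IsCompl T₁ T₂ ∧ IsCompl D.ker (T₂.prod N) ∧
      finrank ℝ T₂ + finrank ℝ N = finrank ℝ Q := by
  have hDadd : ∀ t x, D (t, x) = D (t, 0) + D (0, x) := fun t x => by rw [← map_add]; simp
  let T₁ : Submodule ℝ P :=
    (D ∘ₗ LinearMap.inr ℝ P X).range.comap (D ∘ₗ LinearMap.inl ℝ P X)
  have hT₁ : ∀ t, t ∈ T₁ ↔ ∃ x, D (0, x) = D (t, 0) := fun t => by simp [T₁]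
  obtain ⟨T₂, hT⟩ := Submodule.exists_isCompl T₁
  have hcompl : IsCompl D.ker (T₂.prod N) := by
    constructor
    · rw [Submodule.disjoint_def]
      rintro ⟨t, x⟩ h0 ⟨ht, hx⟩
      rw [LinearMap.mem_ker, hDadd] at h0
      have ht₁ : t ∈ T₁ := (hT₁ t).2 ⟨-x, by
        have : D (0, -x) = -D (0, x) := by rw [← map_neg]; simp
        rw [this]
        exact (eq_neg_of_add_eq_zero_left h0).symm⟩
      have ht0 : t = 0 := (Submodule.disjoint_def.1 hT.disjoint) t ht₁ ht
      subst ht0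
      have hx0 : x = 0 := (Submodule.disjoint_def.1 hN.disjoint) x
        (by rw [← hDadd] at h0; exact h0) hx
      rw [hx0]
      rfl
    · rw [Submodule.codisjoint_iff_exists_add_eq]
      rintro ⟨t, x⟩
      obtain ⟨t₁, t₂, ht₁, ht₂, rfl⟩ := (Submodule.codisjoint_iff_exists_add_eq.1 hT.codisjoint) t
      obtain ⟨x₁, hx₁⟩ := (hT₁ t₁).1 ht₁
      obtain ⟨c, y, hc, hy, hcy⟩ := (Submodule.codisjoint_iff_exists_add_eq.1 hN.codisjoint) (x + x₁)
      refine ⟨(t₁, x - y), (t₂, y), ?_, ⟨ht₂, hy⟩, by simp⟩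
      have hc' : D (0, c) = 0 := hc
      rw [LinearMap.mem_ker, hDadd, ← hx₁, ← map_add]
      convert hc' using 2
      refine Prod.ext (by simp) ?_
      change x₁ + (x - y) = c
      rw [eq_sub_of_add_eq hcy]
      abel
  refine ⟨T₁, T₂, hT, hcompl, ?_⟩
  have h1 := Submodule.finrank_add_eq_of_isCompl hcompl
  have h2 := LinearMap.finrank_range_add_finrank_ker D
  have h3 : finrank ℝ (T₂.prod N) = finrank ℝ T₂ + finrank ℝ N := by
    rw [← Module.finrank_prod]
    exact LinearEquiv.finrank_eq
      { toFun := fun v => (⟨v.1.1, v.2.1⟩, ⟨v.1.2, v.2.2⟩)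
        invFun := fun v => ⟨(v.1, v.2), v.1.2, v.2.2⟩
        map_add' := fun _ _ => rfl
        map_smul' := fun _ _ => rfl }
  rw [hD, finrank_top] at h2
  omega

/-- By the rank condition `N` already maps onto the range of D(0, ·), so `ξ.2` can be replaced by an
element of `N` with the same image. The new vector lies in both disjoint subspaces. -/
theorem fst_eq_zero_of_finrank_range_eq [FiniteDimensional ℝ X] {D : P × X →ₗ[ℝ] Q}
    {T₂ : Submodule ℝ P} {N : Submodule ℝ X}
    (hinj : Disjoint D.ker (T₂.prod N))
    (hrank : finrank ℝ (D ∘ₗ LinearMap.inr ℝ P X).range = finrank ℝ N)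
    {ξ : P × X} (hξ : D ξ = 0) (hξ₁ : ξ.1 ∈ T₂) : ξ.1 = 0 := by
  have hDadd : ∀ t x, D (t, x) = D (t, 0) + D (0, x) := fun t x => by rw [← map_add]; simp
  rw [Submodule.disjoint_def] at hinj
  have hmap : N.map (D ∘ₗ LinearMap.inr ℝ P X) = (D ∘ₗ LinearMap.inr ℝ P X).range := by
    refine Submodule.eq_of_le_of_finrank_eq (LinearMap.map_le_range) ?_
    rw [hrank]
    refine (LinearEquiv.finrank_eq (LinearEquiv.ofBijective
      ((D ∘ₗ LinearMap.inr ℝ P X).submoduleMap N) ⟨?_, ?_⟩)).symm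
    · rw [← LinearMap.ker_eq_bot, LinearMap.ker_eq_bot']
      rintro ⟨y, hy⟩ h
      have h' : D (0, y) = 0 := congrArg Subtype.val h
      have := hinj (0, y) h' ⟨T₂.zero_mem, hy⟩
      exact Subtype.ext (congrArg Prod.snd this)
    · exact LinearMap.submoduleMap_surjective _ _
  have hmem : D (0, ξ.2) ∈ (D ∘ₗ LinearMap.inr ℝ P X).range := ⟨ξ.2, rfl⟩
  rw [← hmap] at hmem
  obtain ⟨y, hy, hyξ⟩ := hmem
  have hyξ' : D (0, y) = D (0, ξ.2) := hyξ
  have h0 : D (ξ.1, y) = 0 := by rw [hDadd, hyξ', ← hDadd]; exact hξ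
  exact congrArg Prod.fst (hinj (ξ.1, y) h0 ⟨hξ₁, hy⟩)

end Splitting

/-- The rank of the derivative of `g` in the second variable. -/
noncomputable def rankSnd {P X Q : Type*} [NormedAddCommGroup P] [NormedSpace ℝ P]
    [NormedAddCommGroup X] [NormedSpace ℝ X] [NormedAddCommGroup Q] [NormedSpace ℝ Q]
    (g : P × X → Q) (z : P × X) : ℕ :=
  finrank ℝ ((fderiv ℝ g z : P × X →ₗ[ℝ] Q) ∘ₗ LinearMap.inr ℝ P X).range

section SingularParameters

variable {P X Q : Type*} [NormedAddCommGroup P] [NormedSpace ℝ P] [FiniteDimensional ℝ P]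
  [NormedAddCommGroup X] [NormedSpace ℝ X] [FiniteDimensional ℝ X]
  [NormedAddCommGroup Q] [NormedSpace ℝ Q] [FiniteDimensional ℝ Q]

/-- A set of parameters is null if it is swept out by a map all of whose derivatives along
the second factor vanish. -/
theorem measure_image_setOf_fderiv_comp_inr_eq_zero [MeasurableSpace P] [BorelSpace P]
    (ν : Measure P) [ν.IsAddHaarMeasure] {T₁ T₂ : Submodule ℝ P} (hT : IsCompl T₁ T₂)
    {C : Type*} [NormedAddCommGroup C] [NormedSpace ℝ C] [FiniteDimensional ℝ C]
    {k : ℕ} (hk : 0 < k) (hT₂ : 0 < finrank ℝ T₂) (hC : finrank ℝ C ≤ k * finrank ℝ T₂)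
    {θ : T₁ × C → P} {W₁ : Set T₁} {W₂ : Set C} (hθ : ∀ w ∈ W₁ ×ˢ W₂, ContDiffAt ℝ k θ w)
    (hθ₁ : ∀ w ∈ W₁ ×ˢ W₂, T₁.projectionOnto T₂ hT (θ w) = w.1)
    {K₁ : Set T₁} {K₂ : Set C} (hK₁ : IsCompact K₁) (hK₂ : IsCompact K₂) (hKW₁ : K₁ ⊆ W₁)
    {u : (Fin (finrank ℝ C) → ℝ) → C} (hu : ContDiff ℝ k u) (huW : range u ⊆ W₂)
    (hKu : K₂ ⊆ range u) :
    ν (θ '' {w ∈ K₁ ×ˢ K₂ | (fderiv ℝ θ w).comp (ContinuousLinearMap.inr ℝ T₁ C) = 0}) = 0 := by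
  have hk1 : (k : WithTop ℕ∞) ≠ 0 := by exact_mod_cast hk.ne'
  have hKW : K₁ ×ˢ K₂ ⊆ W₁ ×ˢ W₂ := prod_mono hKW₁ (hKu.trans huW)
  set S₀ := {w ∈ K₁ ×ˢ K₂ | (fderiv ℝ θ w).comp (ContinuousLinearMap.inr ℝ T₁ C) = 0}
  -- Compactness makes the image closed, hence measurable, as Fubini requires.
  have hS₀ : IsCompact S₀ := by
    have hcont : ContinuousOn
        (fun w => (fderiv ℝ θ w).comp (ContinuousLinearMap.inr ℝ T₁ C)) (K₁ ×ˢ K₂) := by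
      intro w hw
      have h1 : ContinuousAt (fderiv ℝ θ) w :=
        ((hθ w (hKW hw)).fderiv_right (m := 0)
          (by simpa using (by exact_mod_cast hk : (1 : WithTop ℕ∞) ≤ k))).continuousAt
      exact (h1.clm_comp continuousAt_const).continuousWithinAt
    exact (hK₁.prod hK₂).of_isClosed_subset
      (hcont.preimage_isClosed_of_isClosed (hK₁.prod hK₂).isClosed isClosed_singleton)
      (fun w hw => hw.1)
  have hS : IsCompact (θ '' S₀) :=
    hS₀.image_of_continuousOn fun w hw => (hθ w (hKW hw.1)).continuousAt.continuousWithinAt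
  let e : T₂ ≃L[ℝ] (Fin (finrank ℝ T₂) → ℝ) := ContinuousLinearEquiv.ofFinrankEq (by simp)
  let L : (Fin (finrank ℝ T₂) → ℝ) →ₗ[ℝ] P := T₂.subtype ∘ₗ (e.symm : _ →ₗ[ℝ] T₂)
  let κ : P →L[ℝ] (Fin (finrank ℝ T₂) → ℝ) :=
    (e : T₂ →L[ℝ] _).comp (T₂.projectionOnto T₁ hT.symm).toContinuousLinearMap
  have hκL : ∀ v, κ (L v) = v := fun v => by simp [κ, L]
  have hL₁ : ∀ v, T₁.projectionOnto T₂ hT (L v) = 0 := fun v => by simp [L]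
  have hae : ∀ᵐ y ∂ν, y ∈ (θ '' S₀)ᶜ := by
    -- Fubini along cosets of `T₂`. By `hθ₁` the coset of `y` meets the image only at values of `θ
    -- (t, ·)` with `t` the `T₁`-component of `y`, so the slice consists of critical values of `f`.
    refine ae_mem_of_ae_add_linearMap_mem L volume ν hS.isClosed.measurableSet.compl fun y => ?_
    rw [ae_iff]
    simp only [mem_compl_iff, not_not]
    by_cases hy : T₁.projectionOnto T₂ hT y ∈ K₁
    · set t := T₁.projectionOnto T₂ hT y with ht
      let f : (Fin (finrank ℝ C) → ℝ) → (Fin (finrank ℝ T₂) → ℝ) := fun v => κ (θ (t, u v) - y)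
      have hmem : ∀ v, (t, u v) ∈ W₁ ×ˢ W₂ := fun v => ⟨hKW₁ hy, huW (mem_range_self v)⟩
      have hf : ContDiff ℝ k f := by
        rw [contDiff_iff_contDiffAt]
        intro v
        have h1 : ContDiffAt ℝ k (fun v => θ (t, u v)) v :=
          ContDiffAt.comp v (f := fun v => (t, u v)) (hθ _ (hmem v))
            (contDiffAt_const.prodMk hu.contDiffAt)
        exact κ.contDiff.contDiffAt.comp v (h1.sub contDiffAt_const)
      refine measure_mono_null ?_ (volume_image_setOf_fderiv_eq_zero hk hT₂ hC hf)
      rintro v ⟨w, ⟨⟨hw₁, hw₂⟩, hw⟩, hwv⟩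
      have hwt : w.1 = t := by
        rw [← hθ₁ w (hKW ⟨hw₁, hw₂⟩), hwv, map_add, hL₁, add_zero]
      obtain ⟨v', hv'⟩ := hKu hw₂
      have hw' : w = (t, u v') := Prod.ext hwt hv'.symm
      refine ⟨v', ?_, ?_⟩
      · have hθd : HasFDerivAt θ (fderiv ℝ θ (t, u v')) (t, u v') :=
          ((hθ _ (hmem v')).differentiableAt hk1).hasFDerivAt
        have hud : HasFDerivAt u (fderiv ℝ u v') v' :=
          (hu.differentiable hk1 v').hasFDerivAt
        have h1 : HasFDerivAt (fun v => θ (t, u v)) ((fderiv ℝ θ (t, u v')).comp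
            ((0 : (Fin (finrank ℝ C) → ℝ) →L[ℝ] T₁).prod (fderiv ℝ u v'))) v' :=
          hθd.comp v' (f := fun v => (t, u v)) ((hasFDerivAt_const t v').prodMk hud)
        have h2 : HasFDerivAt f _ v' := κ.hasFDerivAt.comp v' (h1.sub_const y)
        change fderiv ℝ f v' = 0
        rw [h2.fderiv]
        ext x : 1
        rw [hw'] at hw
        have h3 := DFunLike.congr_fun hw (fderiv ℝ u v' x)
        have h4 : fderiv ℝ θ (t, u v') (0, fderiv ℝ u v' x) = 0 := h3
        change κ (fderiv ℝ θ (t, u v') (0, fderiv ℝ u v' x)) = 0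
        rw [h4, map_zero]
      · change κ (θ (t, u v') - y) = v
        rw [← hw', hwv, add_sub_cancel_left, hκL]
    · refine measure_mono_null ?_ measure_empty
      rintro v ⟨w, ⟨hw, -⟩, hwv⟩
      refine hy ?_
      have := hθ₁ w (hKW hw)
      rw [hwv, map_add, hL₁, add_zero] at this
      rw [this]
      exact hw.1
  rw [ae_iff] at hae
  simpa only [mem_compl_iff, not_not, ofPred_mem_eq] using hae

theorem exists_nhds_measure_setOf_rankSnd_eq_zero [MeasurableSpace P] [BorelSpace P]
    (ν : Measure P) [ν.IsAddHaarMeasure] {k : ℕ} (hk : 0 < k)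
    (hdim : finrank ℝ X < k + finrank ℝ Q) {g : P × X → Q} {z₀ : P × X}
    (hg : ContDiffAt ℝ k g z₀) (hg₀ : g z₀ = 0)
    (hsurj : Function.Surjective (fderiv ℝ g z₀)) (hrank : rankSnd g z₀ < finrank ℝ Q) :
    ∃ V ∈ 𝓝 z₀, ν {t | ∃ x, (t, x) ∈ V ∧ g (t, x) = 0 ∧ rankSnd g (t, x) = rankSnd g z₀} = 0 := by
  have hk1 : (k : WithTop ℕ∞) ≠ 0 := by exact_mod_cast hk.ne'
  set C : Submodule ℝ X := ((fderiv ℝ g z₀ : P × X →ₗ[ℝ] Q) ∘ₗ LinearMap.inr ℝ P X).ker with hC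
  obtain ⟨N, hN⟩ := Submodule.exists_isCompl C
  obtain ⟨T₁, T₂, hT, hker, hsum⟩ := exists_isCompl_ker_prod
    (LinearMap.range_eq_top.2 hsurj : (fderiv ℝ g z₀ : P × X →ₗ[ℝ] Q).range = ⊤) hN
  have hrankN : rankSnd g z₀ = finrank ℝ N := by
    have h1 := Submodule.finrank_add_eq_of_isCompl hN
    have h2 := LinearMap.finrank_range_add_finrank_ker
      ((fderiv ℝ g z₀ : P × X →ₗ[ℝ] Q) ∘ₗ LinearMap.inr ℝ P X)
    rw [← hC] at h2
    unfold rankSnd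
    omega
  have hT₂ : 0 < finrank ℝ T₂ := by omega
  have hCk : finrank ℝ C ≤ k * finrank ℝ T₂ := by
    have h1 := Submodule.finrank_add_eq_of_isCompl hN
    have h2 : finrank ℝ C + 1 ≤ k + finrank ℝ T₂ := by omega
    -- This is (k - 1)(dim T₂ - 1) ≥ 0.
    have h3 : k + finrank ℝ T₂ ≤ k * finrank ℝ T₂ + 1 := by
      obtain ⟨a, ha⟩ := Nat.exists_eq_add_of_lt hk
      obtain ⟨b, hb⟩ := Nat.exists_eq_add_of_lt hT₂
      rw [ha, hb]
      nlinarith [Nat.zero_le (a * b)]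
    omega
  let R : P × X →L[ℝ] T₁ × C :=
    ((T₁.projectionOnto T₂ hT).prodMap (C.projectionOnto N hN)).toContinuousLinearMap
  have hRker : (R : P × X →ₗ[ℝ] T₁ × C).ker = T₂.prod N := by
    ext z
    simp [R, Submodule.mem_prod]
  have hRrange : (R : P × X →ₗ[ℝ] T₁ × C).range = ⊤ := by
    rw [LinearMap.range_eq_top]
    exact (Submodule.projectionOnto_surjective hT).prodMap (Submodule.projectionOnto_surjective hN)
  let D : ImplicitFunctionData ℝ (P × X) Q (T₁ × C) :=
    { leftFun := g
      leftDeriv := fderiv ℝ g z₀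
      rightFun := R
      rightDeriv := R
      pt := z₀
      hasStrictFDerivAt_leftFun := hg.hasStrictFDerivAt hk1
      hasStrictFDerivAt_rightFun := R.hasStrictFDerivAt
      range_leftDeriv := LinearMap.range_eq_top.2 hsurj
      range_rightDeriv := hRrange
      isCompl_ker := by rw [hRker]; exact hker }
  have himp : ContDiffAt ℝ k D.implicitFunction.uncurry (g z₀, R z₀) :=
    D.contDiffAt_implicitFunction hg R.contDiff.contDiffAt hk1
  rw [hg₀] at himp
  have hleft : ∀ᶠ z in 𝓝 z₀, D.implicitFunction (g z) (R z) = z := D.implicitFunction_apply_image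
  have hright : ∀ᶠ p in 𝓝 ((0 : Q), R z₀), g (D.implicitFunction p.1 p.2) = p.1 ∧
      R (D.implicitFunction p.1 p.2) = p.2 := by
    rw [← hg₀]
    exact D.prodFun_implicitFunction.mono fun p hp => Prod.ext_iff.1 hp
  have hgR : ContinuousAt (fun z => (g z, R z)) z₀ := hg.continuousAt.prodMk R.continuous.continuousAt
  -- Differentiating the identity `hleft` at nearby `z` shows that a vector killed by both Dg and
  -- `R` is zero.
  have hO : ∀ᶠ z in 𝓝 z₀, DifferentiableAt ℝ g z ∧
      Disjoint (fderiv ℝ g z : P × X →ₗ[ℝ] Q).ker (T₂.prod N) := by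
    have hgd : ∀ᶠ z in 𝓝 z₀, DifferentiableAt ℝ g z :=
      (hg.eventually (by simp)).mono fun z hz => hz.differentiableAt hk1
    have himpd : ∀ᶠ z in 𝓝 z₀, DifferentiableAt ℝ D.implicitFunction.uncurry (g z, R z) := by
      refine hgR.eventually ?_
      simp only [hg₀]
      exact (himp.eventually (by simp)).mono fun z hz => hz.differentiableAt hk1
    filter_upwards [hgd, himpd, hleft.eventually_nhds] with z hz hz' hzl
    refine ⟨hz, Submodule.disjoint_def.2 fun ξ hξ hξ' => ?_⟩
    rw [← hRker] at hξ'
    have h1 := hz'.hasFDerivAt.comp z (f := fun z => (g z, R z))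
      (hz.hasFDerivAt.prodMk R.hasFDerivAt)
    have h2 := (hasFDerivAt_id (𝕜 := ℝ) z).congr_of_eventuallyEq
      (show D.implicitFunction.uncurry ∘ (fun z => (g z, R z)) =ᶠ[𝓝 z] id from hzl)
    have h3 := DFunLike.congr_fun (h1.unique h2) ξ
    have hξ0 : fderiv ℝ g z ξ = 0 := hξ
    have hξ1 : R ξ = 0 := hξ'
    have h4 : fderiv ℝ D.implicitFunction.uncurry (g z, R z) (fderiv ℝ g z ξ, R ξ) = ξ := h3
    rw [hξ0, hξ1] at h4
    rw [← h4]
    exact ContinuousLinearMap.map_zero _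
  let Ψ : T₁ × C → P × X := fun w => D.implicitFunction 0 w
  have hΨ₀ : Ψ (R z₀) = z₀ := by
    have := hleft.self_of_nhds
    rwa [hg₀] at this
  have hslice : Continuous fun w : T₁ × C => ((0 : Q), w) := by fun_prop
  have hΨc : ContDiffAt ℝ k Ψ (R z₀) :=
    ContDiffAt.comp (R z₀) (f := fun w => ((0 : Q), w)) himp
      (contDiffAt_const.prodMk contDiffAt_id)
  have hW : ∀ᶠ w in 𝓝 (R z₀), ContDiffAt ℝ k Ψ w ∧ (g (Ψ w) = 0 ∧ R (Ψ w) = w) ∧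
      DifferentiableAt ℝ g (Ψ w) ∧
      Disjoint (fderiv ℝ g (Ψ w) : P × X →ₗ[ℝ] Q).ker (T₂.prod N) := by
    refine (hΨc.eventually (by simp)).and (Eventually.and ?_ ?_)
    · exact hslice.continuousAt.eventually hright
    · rw [← hΨ₀] at hO
      exact hΨc.continuousAt.eventually hO
  obtain ⟨W₁, W₂, hW₁, hW₁m, hW₂, hW₂m, hWsub⟩ := mem_nhds_prod_iff'.1 hW
  obtain ⟨K₁, hK₁m, hK₁W, hK₁⟩ := local_compact_nhds (hW₁.mem_nhds hW₁m)
  obtain ⟨u, hu, huW, hum⟩ := exists_contDiff_range_mem_nhds rfl (hW₂.mem_nhds hW₂m)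
  obtain ⟨K₂, hK₂m, hK₂u, hK₂⟩ := local_compact_nhds hum
  refine ⟨{z | D.implicitFunction (g z) (R z) = z ∧ R z ∈ K₁ ×ˢ K₂}, ?_, ?_⟩
  · exact hleft.and (R.continuous.continuousAt.eventually (prod_mem_nhds hK₁m hK₂m))
  · refine measure_mono_null ?_ (measure_image_setOf_fderiv_comp_inr_eq_zero ν hT hk hT₂ hCk
      (θ := fun w => (Ψ w).1) (W₁ := W₁) (W₂ := W₂)
      (fun w hw => contDiff_fst.contDiffAt.comp w (hWsub hw).1) (fun w hw => ?_) hK₁ hK₂ hK₁W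
      (hu.of_le (by exact_mod_cast le_top)) huW hK₂u)
    · rintro t ⟨x, ⟨hx, hxK⟩, hgx, hrk⟩
      rw [hgx] at hx
      have hx' : Ψ (R (t, x)) = (t, x) := hx
      refine ⟨R (t, x), ⟨hxK, ?_⟩, by simp only [hx']⟩
      have hRW : R (t, x) ∈ W₁ ×ˢ W₂ := ⟨hK₁W hxK.1, huW (hK₂u hxK.2)⟩
      obtain ⟨hΨw, -, hgw, hdisj⟩ := hWsub hRW
      have hev := (hW₁.prod hW₂).mem_nhds hRW
      have hΨd : HasFDerivAt Ψ (fderiv ℝ Ψ (R (t, x))) (R (t, x)) :=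
        (hΨw.differentiableAt hk1).hasFDerivAt
      ext c : 1
      have hfst : HasFDerivAt (fun w => (Ψ w).1)
          ((ContinuousLinearMap.fst ℝ P X).comp (fderiv ℝ Ψ (R (t, x)))) (R (t, x)) :=
        (ContinuousLinearMap.fst ℝ P X).hasFDerivAt.comp _ hΨd
      rw [hfst.fderiv]
      change (fderiv ℝ Ψ (R (t, x)) (0, c)).1 = 0
      have h1 := DFunLike.congr_fun ((hgw.hasFDerivAt.comp _ hΨd).unique
        ((hasFDerivAt_const (0 : Q) (R (t, x))).congr_of_eventuallyEq
          (mem_of_superset hev fun w hw => (hWsub hw).2.1.1))) (0, c)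
      have h2 := DFunLike.congr_fun ((R.hasFDerivAt.comp _ hΨd).unique
        ((hasFDerivAt_id (R (t, x))).congr_of_eventuallyEq
          (mem_of_superset hev fun w hw => (hWsub hw).2.1.2))) (0, c)
      -- The derivative of `Ψ` along `(0, c)` is in the kernel of Dg, since `g ∘ Ψ` vanishes, and
      -- its parameter component is in `T₂`, since `R ∘ Ψ` is the identity.
      refine fst_eq_zero_of_finrank_range_eq (T₂ := T₂) (N := N) hdisj ?_ h1 ?_
      · rw [← hrankN, ← hrk, hx']
        rfl
      · have h3 := congrArg Prod.fst h2
        exact (Submodule.projectionOnto_apply_eq_zero_iff hT).1 h3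
    · exact congrArg Prod.fst (hWsub hw).2.1.2

/-- The set of parameters `t` for which `0` is not a regular value of `g (t, ·)` is null. -/
theorem measure_setOf_not_surjective_eq_zero [MeasurableSpace P] [BorelSpace P]
    (ν : Measure P) [ν.IsAddHaarMeasure] {k : ℕ} (hk : 0 < k)
    (hdim : finrank ℝ X < k + finrank ℝ Q) {g : P × X → Q} {Z : Set (P × X)}
    (hg : ∀ z ∈ Z, ContDiffAt ℝ k g z) (hg₀ : ∀ z ∈ Z, g z = 0)
    (hsurj : ∀ z ∈ Z, Function.Surjective (fderiv ℝ g z))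
    (hns : ∀ z ∈ Z, ¬ Function.Surjective
      ((fderiv ℝ g z).comp (ContinuousLinearMap.inr ℝ P X))) :
    ν (Prod.fst '' Z) = 0 := by
  have hrank : ∀ z ∈ Z, rankSnd g z < finrank ℝ Q := by
    intro z hz
    refine Submodule.finrank_lt fun h => hns z hz ?_
    exact LinearMap.range_eq_top.1 h
  have hex : ∀ z ∈ Z, ∃ V ∈ 𝓝 z,
      ν {t | ∃ x, (t, x) ∈ V ∧ g (t, x) = 0 ∧ rankSnd g (t, x) = rankSnd g z} = 0 :=
    fun z hz => exists_nhds_measure_setOf_rankSnd_eq_zero ν hk hdim (hg z hz) (hg₀ z hz)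
      (hsurj z hz) (hrank z hz)
  choose! V hV hνV using hex
  -- The null set attached to a centre captures only zeros of the same rank, so a countable cover is
  -- chosen within each stratum.
  have hstrat : ∀ ρ : ℕ, ν (Prod.fst '' (Z ∩ {z | rankSnd g z = ρ})) = 0 := by
    intro ρ
    obtain ⟨t, htZ, htc, hcov⟩ := TopologicalSpace.countable_cover_nhdsWithin
      (s := Z ∩ {z | rankSnd g z = ρ}) fun z hz => mem_nhdsWithin_of_mem_nhds (hV z hz.1)
    refine measure_mono_null ?_ ((measure_biUnion_null_iff htc).2 fun z hz => hνV z (htZ hz).1)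
    rintro _ ⟨⟨a, x⟩, hz, rfl⟩
    obtain ⟨y, hy, hzy⟩ := mem_iUnion₂.1 (hcov hz)
    exact mem_iUnion₂.2 ⟨y, hy, x, hzy, hg₀ _ hz.1, hz.2.trans (htZ hy).2.symm⟩
  refine measure_mono_null ?_ (measure_iUnion_null hstrat)
  rintro _ ⟨z, hz, rfl⟩
  exact mem_iUnion.2 ⟨rankSnd g z, mem_image_of_mem _ ⟨hz, rfl⟩⟩

end SingularParameters

/-! ### Haar null sets from null slices -/

section Splice

/-- Replace the first `m` terms of a sequence. -/
def spliceFirst (m : ℕ) (p : (ℕ → ℝ) × (Fin m → ℝ)) : ℕ → ℝ :=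
  fun i => if h : i < m then p.2 ⟨i, h⟩ else p.1 i

theorem measurable_spliceFirst (m : ℕ) : Measurable (spliceFirst m) := by
  refine measurable_pi_lambda _ fun i => ?_
  unfold spliceFirst
  split_ifs with h
  · exact (measurable_pi_apply _).comp measurable_snd
  · exact (measurable_pi_apply _).comp measurable_fst

/-- Resampling the first `m` coordinates independently preserves the product law; this lets Fubini
isolate them without splitting the index set. -/
theorem map_spliceFirst_infinitePi (η : Measure ℝ) [IsProbabilityMeasure η] (m : ℕ) :
    ((Measure.infinitePi fun _ : ℕ => η).prod (Measure.pi fun _ : Fin m => η)).map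
      (spliceFirst m) = Measure.infinitePi fun _ : ℕ => η := by
  refine Measure.eq_infinitePi _ fun s t ht => ?_
  have hpre : spliceFirst m ⁻¹' (Set.pi s t) =
      (Set.pi (s.filter fun i => m ≤ i) t) ×ˢ
        (Set.pi univ fun i : Fin m => if (i : ℕ) ∈ s then t i else univ) := by
    ext ⟨a, b⟩
    simp only [mem_preimage, Set.mem_pi, mem_prod, Finset.coe_filter, mem_ofPred_eq, spliceFirst,
      Finset.mem_coe]
    constructor
    · intro h
      refine ⟨fun i hi => ?_, fun i _ => ?_⟩
      · have := h i hi.1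
        rwa [dif_neg (not_lt.2 hi.2)] at this
      · split_ifs with his
        · have := h i his
          rwa [dif_pos i.2] at this
        · trivial
    · rintro ⟨h1, h2⟩ i hi
      split_ifs with him
      · have := h2 ⟨i, him⟩ trivial
        rwa [if_pos hi] at this
      · exact h1 i ⟨hi, not_lt.1 him⟩
  rw [Measure.map_apply (measurable_spliceFirst m)
      (MeasurableSet.pi s.countable_toSet fun i _ => ht i), hpre, Measure.prod_prod,
    Measure.infinitePi_pi _ (fun i _ => ht i), Measure.pi_pi]
  have h1 : ∀ i : Fin m, η (if (i : ℕ) ∈ s then t i else univ) =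
      (fun j : ℕ => if j ∈ s then η (t j) else 1) i := by
    intro i
    dsimp only
    split_ifs
    · rfl
    · exact measure_univ
  simp_rw [h1]
  rw [← Finset.prod_range (fun j : ℕ => if j ∈ s then η (t j) else 1), Finset.prod_ite_mem,
    ← Finset.prod_filter_mul_prod_filter_not s (fun i => m ≤ i)]
  congr 2
  ext i
  simp [and_comm]

end Splice

theorem isHaarNull_of_null_slices {E : Type*} [NormedAddCommGroup E] [NormedSpace ℝ E]
    [CompleteSpace E] [MeasurableSpace E] [BorelSpace E] {w : ℕ → E}
    (hw : Summable fun i => ‖w i‖) {ι : Type*} [Countable ι] {S : ι → Set E}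
    (hS : ∀ j, MeasurableSet (S j))
    (hnull : ∀ j, ∃ m : ℕ, ∀ e : E, volume {s : Fin m → ℝ | e + ∑ i, s i • w i ∈ S j} = 0)
    {B : Set E} (hB : B ⊆ ⋃ j, S j) : IsHaarNull B := by
  let η : Measure ℝ := volume.restrict (Icc 0 1)
  have : IsProbabilityMeasure η := ⟨by simp [η]⟩
  let M : Measure (ℕ → ℝ) := Measure.infinitePi fun _ => η
  -- Clamping to [0,1], where `η` lives, makes the series converge for every `t`, so that `T` is
  -- continuous with compact range.
  let c : ℝ → ℝ := fun t => projIcc (0 : ℝ) 1 zero_le_one t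
  have hcc : Continuous c := continuous_subtype_val.comp continuous_projIcc
  have hc : ∀ t, c t ∈ Icc (0 : ℝ) 1 := fun t => (projIcc (0 : ℝ) 1 zero_le_one t).2
  have hcid : ∀ t ∈ Icc (0 : ℝ) 1, c t = t := fun t ht => by
    simp [c, projIcc_of_mem zero_le_one ht]
  let T : (ℕ → ℝ) → E := fun t => ∑' i, c (t i) • w i
  have hbound : ∀ (i : ℕ) (t : ℕ → ℝ), ‖c (t i) • w i‖ ≤ ‖w i‖ := fun i t => by
    rw [norm_smul, Real.norm_of_nonneg (hc _).1]
    exact mul_le_of_le_one_left (norm_nonneg _) (hc _).2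
  have hTc : Continuous T :=
    continuous_tsum (fun i => (hcc.comp (continuous_apply i)).smul continuous_const) hw hbound
  have hsum : ∀ t : ℕ → ℝ, Summable fun i => c (t i) • w i := fun t =>
    Summable.of_norm_bounded hw fun i => hbound i t
  refine ⟨⋃ j, S j, hB, MeasurableSet.iUnion hS, M.map T, inferInstance, ?_, ?_, fun x => ?_⟩
  · have : IsProbabilityMeasure (M.map T) :=
      Measure.isProbabilityMeasure_map hTc.measurable.aemeasurable
    exact IsProbabilityMeasure.ne_zero _
  · have hK : IsCompact (T '' Set.pi univ fun _ => Icc (0 : ℝ) 1) :=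
      (isCompact_univ_pi fun _ => isCompact_Icc).image hTc
    refine ⟨_, hK, ?_⟩
    rw [Measure.map_apply hTc.measurable hK.isClosed.measurableSet.compl]
    convert measure_empty (μ := M)
    rw [eq_empty_iff_forall_notMem]
    intro t ht
    refine ht ⟨fun i => c (t i), fun i _ => hc _, ?_⟩
    simp only [T, hcid _ (hc _)]
  · have hpre : (fun y => x + y) '' (⋃ j, S j) = ⋃ j, (fun y => -x + y) ⁻¹' S j := by
      rw [← preimage_iUnion]
      exact Set.image_add_left
    rw [hpre]
    refine measure_iUnion_null fun j => ?_
    have hAm : MeasurableSet ((fun y => -x + y) ⁻¹' S j) :=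
      (continuous_const.add continuous_id).measurable (hS j)
    obtain ⟨m, hm⟩ := hnull j
    rw [Measure.map_apply hTc.measurable hAm]
    change (Measure.infinitePi fun _ : ℕ => η) _ = 0
    have hTm := hTc.measurable hAm
    rw [← map_spliceFirst_infinitePi η m, Measure.map_apply (measurable_spliceFirst m) hTm,
      Measure.measure_prod_null (measurable_spliceFirst m hTm)]
    refine Eventually.of_forall fun t => ?_
    change (Measure.pi fun _ : Fin m => η) _ = 0
    rw [← Measure.restrict_pi_pi, Measure.restrict_apply
      (measurable_prodMk_left (measurable_spliceFirst m hTm))]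
    -- The translation and the tail of the series are absorbed in the base point of the slice; hence
    -- one measure works for all `x` and all `j`, whatever `m` is.
    refine measure_mono_null ?_ (hm (-x + ∑' i, c (t (i + m)) • w (i + m)))
    rintro s ⟨hs, hsI⟩
    have hs' : -x + T (spliceFirst m (t, s)) ∈ S j := hs
    have hT : T (spliceFirst m (t, s)) =
        (∑ i, s i • w i) + ∑' i, c (t (i + m)) • w (i + m) := by
      change ∑' i, c (spliceFirst m (t, s) i) • w i = _
      rw [← (hsum (spliceFirst m (t, s))).sum_add_tsum_nat_add m, Finset.sum_range]
      congr 1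
      · refine Finset.sum_congr rfl fun i _ => ?_
        simp only [spliceFirst, dif_pos i.2, hcid _ (hsI i trivial)]
      · refine tsum_congr fun i => ?_
        simp [spliceFirst]
    rw [hT] at hs'
    change -x + ∑' i, c (t (i + m)) • w (i + m) + ∑ i, s i • w i ∈ S j
    rwa [add_assoc, add_comm (∑' i, c (t (i + m)) • w (i + m))]

/-- An open subset of `A` containing `a` pulls back to a nonempty open subset of ℝ^m, which has
positive volume and so cannot consist of parameters landing in `S`. -/
theorem subset_closure_diff_of_null_slices {E : Type*} [NormedAddCommGroup E] [NormedSpace ℝ E]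
    {w : ℕ → E} {A S : Set E} (hA : IsOpen A) {m : ℕ}
    (hnull : ∀ e : E, volume {s : Fin m → ℝ | e + ∑ i, s i • w i ∈ S} = 0) :
    A ⊆ closure (A \ S) := by
  intro a ha
  rw [mem_closure_iff]
  intro O hO haO
  have hcont : Continuous fun s : Fin m → ℝ => a + ∑ i, s i • w i := by fun_prop
  have hopen : IsOpen ((fun s : Fin m → ℝ => a + ∑ i, s i • w i) ⁻¹' (O ∩ A)) :=
    (hO.inter hA).preimage hcont
  have hne : ((fun s : Fin m → ℝ => a + ∑ i, s i • w i) ⁻¹' (O ∩ A)).Nonempty :=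
    ⟨0, by simp [haO, ha]⟩
  have hpos := hopen.measure_pos volume hne
  by_contra hcon
  refine hpos.ne' (measure_mono_null (fun s hs => ?_) (hnull a))
  by_contra hsS
  exact hcon ⟨_, hs.1, hs.2, hsS⟩

theorem exists_summable_norm_dense_span (E : Type*) [NormedAddCommGroup E] [NormedSpace ℝ E]
    [TopologicalSpace.SeparableSpace E] :
    ∃ w : ℕ → E, (Summable fun i => ‖w i‖) ∧ Dense (Submodule.span ℝ (range w) : Set E) := by
  let v := TopologicalSpace.denseSeq E
  let a : ℕ → ℝ := fun i => (1 / 2) ^ i / (1 + ‖v i‖)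
  have ha : ∀ i, 0 < a i := fun i => by positivity
  refine ⟨fun i => a i • v i, ?_, ?_⟩
  · refine Summable.of_nonneg_of_le (fun i => norm_nonneg _) (fun i => ?_) summable_geometric_two
    rw [norm_smul, Real.norm_of_nonneg (ha i).le, div_mul_eq_mul_div, div_le_iff₀ (by positivity)]
    gcongr
    linarith
  · refine (TopologicalSpace.denseRange_denseSeq E).mono ?_
    rintro _ ⟨i, rfl⟩
    have h := Submodule.smul_mem (Submodule.span ℝ (range fun i => a i • v i)) (a i)⁻¹
      (Submodule.subset_span (mem_range_self i))
    rwa [inv_smul_smul₀ (ha i).ne'] at h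

/-! ### Singular parameters in a Banach space -/

theorem ContinuousLinearMap.isOpen_setOf_surjective_of_finiteDimensional {V Q : Type*}
    [NormedAddCommGroup V] [NormedSpace ℝ V] [NormedAddCommGroup Q] [NormedSpace ℝ Q]
    [FiniteDimensional ℝ Q] : IsOpen {D : V →L[ℝ] Q | Function.Surjective D} := by
  rw [isOpen_iff_mem_nhds]
  intro D hD
  obtain ⟨R, hR⟩ := (D : V →ₗ[ℝ] Q).exists_rightInverse_of_surjective (LinearMap.range_eq_top.2 hD)
  have : CompleteSpace Q := FiniteDimensional.complete ℝ Q
  have hcont : Continuous fun D' : V →L[ℝ] Q => D'.comp R.toContinuousLinearMap := by fun_prop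
  have hunit : {T : Q →L[ℝ] Q | IsUnit T} ∈ 𝓝 (D.comp R.toContinuousLinearMap) := by
    refine Units.isOpen.mem_nhds ?_
    have h1 : D.comp R.toContinuousLinearMap = 1 := by
      ext q
      exact DFunLike.congr_fun hR q
    rw [h1]
    exact isUnit_one
  filter_upwards [hcont.continuousAt.preimage_mem_nhds hunit] with D' hD' q
  obtain ⟨T, hT⟩ : IsUnit (D'.comp R.toContinuousLinearMap) := hD'
  refine ⟨R ((↑T⁻¹ : Q →L[ℝ] Q) q), ?_⟩
  have h := DFunLike.congr_fun T.mul_inv q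
  rw [hT] at h
  exact h

/-- The linear combination of the first `m` terms of a sequence of vectors. -/
noncomputable def combFirst {E : Type*} [NormedAddCommGroup E] [NormedSpace ℝ E] (w : ℕ → E)
    (m : ℕ) : (Fin m → ℝ) →L[ℝ] E :=
  ∑ i : Fin m, (ContinuousLinearMap.proj i : (Fin m → ℝ) →L[ℝ] ℝ).smulRight (w i)

section BanachParameters

variable {E : Type*} [NormedAddCommGroup E] [NormedSpace ℝ E] {w : ℕ → E}

theorem combFirst_apply (w : ℕ → E) (m : ℕ) (s : Fin m → ℝ) :
    combFirst w m s = ∑ i, s i • w i := by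
  simp [combFirst]

variable {EX : Type*} [NormedAddCommGroup EX] [NormedSpace ℝ EX]
  {Q : Type*} [NormedAddCommGroup Q] [NormedSpace ℝ Q] [FiniteDimensional ℝ Q]

/-- The ranges increase with `m` inside the finite-dimensional `Q`, hence stabilize. The final one
is closed, so it contains the image of the closure of the span. -/
theorem exists_surjective_comp_combFirst (hw : Dense (Submodule.span ℝ (range w) : Set E))
    {D : E × EX →L[ℝ] Q} (hD : Function.Surjective D) :
    ∃ m, Function.Surjective (D.comp ((combFirst w m).prodMap (ContinuousLinearMap.id ℝ EX))) := by
  let r : ℕ → Submodule ℝ Q := fun m =>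
    (D.comp ((combFirst w m).prodMap (ContinuousLinearMap.id ℝ EX)) :
      (Fin m → ℝ) × EX →ₗ[ℝ] Q).range
  have hmem : ∀ m q, q ∈ r m ↔ ∃ s x, D (combFirst w m s, x) = q := fun m q => by
    simp [r]
  have hmono : Monotone r := by
    refine monotone_nat_of_le_succ fun m q hq => ?_
    obtain ⟨s, x, rfl⟩ := (hmem m q).1 hq
    refine (hmem _ _).2 ⟨Fin.snoc s 0, x, ?_⟩
    congr 2
    rw [combFirst_apply, combFirst_apply, Fin.sum_univ_castSucc]
    simp
  obtain ⟨m, hm⟩ := monotone_stabilizes_iff_noetherian.2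
    (inferInstance : IsNoetherian ℝ Q) ⟨r, hmono⟩
  have hmax : ∀ j, r j ≤ r m := fun j => by
    rcases le_total j m with h | h
    · exact hmono h
    · exact (hm j h).ge
  have h0 : ∀ x, D (0, x) ∈ r m := fun x => (hmem m _).2 ⟨0, x, by rw [map_zero]⟩
  have hspan : Submodule.span ℝ (range w) ≤
      (r m).comap (D.comp (ContinuousLinearMap.inl ℝ E EX) : E →ₗ[ℝ] Q) := by
    rw [Submodule.span_le]
    rintro _ ⟨i, rfl⟩
    refine hmax (i + 1) ((hmem _ _).2 ⟨Fin.snoc 0 1, 0, ?_⟩)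
    rw [combFirst_apply, Fin.sum_univ_castSucc]
    simp
  have hclosed : IsClosed ((fun e : E => D (e, 0)) ⁻¹' (r m : Set Q)) :=
    (r m).closed_of_finiteDimensional.preimage (by fun_prop)
  have hall : ∀ e : E, D (e, 0) ∈ r m := fun e =>
    hclosed.closure_subset_iff.2 (fun e he => hspan he) (hw e)
  refine ⟨m, LinearMap.range_eq_top.1 (show r m = ⊤ from ?_)⟩
  rw [eq_top_iff]
  intro q _
  obtain ⟨⟨e, x⟩, rfl⟩ := hD q
  have : D (e, x) = D (e, 0) + D (0, x) := by rw [← map_add]; simp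
  rw [this]
  exact (r m).add_mem (hall e) (h0 x)

variable [FiniteDimensional ℝ EX]

/-- Near a zero of `g` where the derivative of `g` is onto, the parameters `a` for which
`0` fails to be a regular value of `g (a, ·)` belong to a closed set with null slices. -/
theorem exists_closed_null_slices (hw : Dense (Submodule.span ℝ (range w) : Set E))
    {k : ℕ} (hk : 0 < k) (hdim : finrank ℝ EX < k + finrank ℝ Q) {g : E × EX → Q} {z₀ : E × EX}
    (hg : ContDiffAt ℝ k g z₀) (hsurj : Function.Surjective (fderiv ℝ g z₀)) :
    ∃ V ∈ 𝓝 z₀, ∃ S : Set E, IsClosed S ∧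
      (∃ m : ℕ, ∀ e : E, volume {s : Fin m → ℝ | e + ∑ i, s i • w i ∈ S} = 0) ∧
      ∀ z ∈ V, g z = 0 →
        ¬ Function.Surjective ((fderiv ℝ g z).comp (ContinuousLinearMap.inr ℝ E EX)) →
        z.1 ∈ S := by
  have hk1 : (k : WithTop ℕ∞) ≠ 0 := by exact_mod_cast hk.ne'
  obtain ⟨m, hm⟩ := exists_surjective_comp_combFirst hw hsurj
  have hfd : ∀ z, ContDiffAt ℝ k g z → ContinuousAt (fderiv ℝ g) z := fun z hz =>
    (hz.fderiv_right (m := 0)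
      (by simpa using (by exact_mod_cast hk : (1 : WithTop ℕ∞) ≤ k))).continuousAt
  have hΩ : ∀ᶠ z in 𝓝 z₀, ContDiffAt ℝ k g z ∧ Function.Surjective
      ((fderiv ℝ g z).comp ((combFirst w m).prodMap (ContinuousLinearMap.id ℝ EX))) := by
    refine (hg.eventually (by simp)).and ?_
    exact ((hfd z₀ hg).clm_comp continuousAt_const).eventually
      (ContinuousLinearMap.isOpen_setOf_surjective_of_finiteDimensional.mem_nhds hm)
  obtain ⟨δ, hδ, hball⟩ := Metric.nhds_basis_closedBall.mem_iff.1 hΩ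
  rw [← Prod.mk.eta (p := z₀), ← closedBall_prod_same] at hball
  let K := Metric.closedBall z₀.2 δ
  -- Projection along a compact factor is closed, which makes the bad set `Prod.fst '' Z` closed.
  have hKc : CompactSpace K := isCompact_iff_compactSpace.1 (isCompact_closedBall _ _)
  let Z : Set (E × EX) := {z ∈ Metric.closedBall z₀.1 δ ×ˢ K | g z = 0 ∧
    ¬ Function.Surjective ((fderiv ℝ g z).comp (ContinuousLinearMap.inr ℝ E EX))}
  have hZ : IsClosed Z := by
    have hcl : IsClosed (Metric.closedBall z₀.1 δ ×ˢ K) :=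
      Metric.isClosed_closedBall.prod Metric.isClosed_closedBall
    have hcont : ContinuousOn
        (fun z => (g z, (fderiv ℝ g z).comp (ContinuousLinearMap.inr ℝ E EX)))
        (Metric.closedBall z₀.1 δ ×ˢ K) := fun z hz =>
      ((hball hz).1.continuousAt.prodMk
        ((hfd z (hball hz).1).clm_comp continuousAt_const)).continuousWithinAt
    exact hcont.preimage_isClosed_of_isClosed hcl (isClosed_singleton (x := (0 : Q)) |>.prod
      ContinuousLinearMap.isOpen_setOf_surjective_of_finiteDimensional.isClosed_compl)
  have hS : IsClosed (Prod.fst '' Z) := by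
    have h1 : IsClosed ((fun p : E × K => (p.1, (p.2 : EX))) ⁻¹' Z) :=
      hZ.preimage (by fun_prop)
    have h2 := isClosedMap_fst_of_compactSpace _ h1
    convert h2 using 1
    ext a
    constructor
    · rintro ⟨z, hz, rfl⟩
      exact ⟨(z.1, ⟨z.2, hz.1.2⟩), hz, rfl⟩
    · rintro ⟨p, hp, rfl⟩
      exact ⟨_, hp, rfl⟩
  refine ⟨Metric.closedBall z₀.1 δ ×ˢ K, ?_, Prod.fst '' Z, hS, ⟨m, fun e => ?_⟩,
    fun z hz h0 hns => ⟨z, ⟨hz, h0, hns⟩, rfl⟩⟩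
  · exact prod_mem_nhds (Metric.closedBall_mem_nhds _ hδ) (Metric.closedBall_mem_nhds _ hδ)
  -- Restrict `g` to the affine slice through `e`. At points of `Z` the restricted derivative is
  -- onto by the choice of `m`, while its `EX`-part is still not onto.
  · let A : (Fin m → ℝ) × EX → E × EX := fun p => (e + combFirst w m p.1, p.2)
    have hA : ∀ p, HasFDerivAt A
        ((combFirst w m).prodMap (ContinuousLinearMap.id ℝ EX)) p := fun p =>
      (((combFirst w m).hasFDerivAt.comp p hasFDerivAt_fst).const_add e).prodMk hasFDerivAt_snd
    have hAc : ContDiff ℝ k A := by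
      refine ContDiff.prodMk (contDiff_const.add ?_) contDiff_snd
      exact (combFirst w m).contDiff.comp contDiff_fst
    have hfder : ∀ p ∈ A ⁻¹' Z, fderiv ℝ (g ∘ A) p =
        (fderiv ℝ g (A p)).comp ((combFirst w m).prodMap (ContinuousLinearMap.id ℝ EX)) :=
      fun p hp => (((hball hp.1).1.differentiableAt hk1).hasFDerivAt.comp p (hA p)).fderiv
    have hnull := measure_setOf_not_surjective_eq_zero volume hk hdim (g := g ∘ A) (Z := A ⁻¹' Z)
      (fun p hp => (hball hp.1).1.comp p hAc.contDiffAt) (fun p hp => hp.2.1)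
      (fun p hp => by rw [hfder p hp]; exact (hball hp.1).2)
      (fun p hp => by
        rw [hfder p hp]
        convert hp.2.2 using 2
        ext x
        change fderiv ℝ g (A p) (combFirst w m 0, x) = fderiv ℝ g (A p) (0, x)
        rw [map_zero])
    refine measure_mono_null ?_ hnull
    rintro s ⟨z, hz, hzs⟩
    refine ⟨(s, z.2), ?_, rfl⟩
    have : A (s, z.2) = z := by
      refine Prod.ext ?_ rfl
      change e + combFirst w m s = z.1
      rw [combFirst_apply, hzs]
    rw [mem_preimage, this]
    exact hz

end BanachParameters

/-! ### Transversality in terms of defining maps -/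

section DefiningMap

theorem exists_clm_ker_eq {F : Type*} [NormedAddCommGroup F] [NormedSpace ℝ F] {G : Submodule ℝ F}
    (hG : IsClosed (G : Set F)) [Module.Finite ℝ (F ⧸ G)] {q : ℕ} (hq : finrank ℝ (F ⧸ G) = q) :
    ∃ ℓ : F →L[ℝ] (Fin q → ℝ), Function.Surjective ℓ ∧ ∀ v, ℓ v = 0 ↔ v ∈ G := by
  have : IsClosed (G : Set F) := hG
  let e : (F ⧸ G) ≃ₗ[ℝ] (Fin q → ℝ) := LinearEquiv.ofFinrankEq _ _ (by simp [hq])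
  have he : Continuous (e : (F ⧸ G) →ₗ[ℝ] (Fin q → ℝ)) := LinearMap.continuous_of_finiteDimensional _
  refine ⟨⟨(e : (F ⧸ G) →ₗ[ℝ] (Fin q → ℝ)) ∘ₗ G.mkQ, he.comp continuous_quot_mk⟩,
    e.surjective.comp G.mkQ_surjective, fun v => ?_⟩
  change e (G.mkQ v) = 0 ↔ v ∈ G
  rw [LinearEquiv.map_eq_zero_iff, Submodule.mkQ_apply, Submodule.Quotient.mk_eq_zero]

variable {V F Q : Type*} [NormedAddCommGroup V] [NormedSpace ℝ V] [NormedAddCommGroup F]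
  [NormedSpace ℝ F] [NormedAddCommGroup Q] [NormedSpace ℝ Q]

theorem surjective_comp_of_isCompl_le_range {T : V →L[ℝ] F} {Λ : F →L[ℝ] Q}
    (hΛ : Function.Surjective Λ) {C : Submodule ℝ F} (hC : C ≤ (T : V →ₗ[ℝ] F).range)
    (hcompl : IsCompl (Λ : F →ₗ[ℝ] Q).ker C) : Function.Surjective (Λ.comp T) := by
  intro y
  obtain ⟨v, rfl⟩ := hΛ y
  obtain ⟨a, c, ha, hc, rfl⟩ := (Submodule.codisjoint_iff_exists_add_eq.1 hcompl.codisjoint) v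
  obtain ⟨u, hu⟩ := hC hc
  have ha' : Λ a = 0 := ha
  have hu' : T u = c := hu
  refine ⟨u, ?_⟩
  rw [ContinuousLinearMap.comp_apply, hu', map_add, ha', zero_add]

/-- The image under `T` of a complement of the kernel of `Λ ∘ T` works; it is closed because `V` is
finite-dimensional. -/
theorem exists_isCompl_le_range_of_surjective_comp [FiniteDimensional ℝ V] {T : V →L[ℝ] F}
    {Λ : F →L[ℝ] Q} (h : Function.Surjective (Λ.comp T)) :
    ∃ C : Submodule ℝ F, IsClosed (C : Set F) ∧ C ≤ (T : V →ₗ[ℝ] F).range ∧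
      IsCompl (Λ : F →ₗ[ℝ] Q).ker C := by
  obtain ⟨U, hU⟩ := Submodule.exists_isCompl (Λ.comp T : V →ₗ[ℝ] Q).ker
  refine ⟨U.map (T : V →ₗ[ℝ] F), Submodule.closed_of_finiteDimensional _,
    LinearMap.map_le_range, ?_, ?_⟩
  · rw [Submodule.disjoint_def]
    rintro _ hv ⟨u, hu, rfl⟩
    have : u = 0 := (Submodule.disjoint_def.1 hU.disjoint) u hv hu
    rw [this, map_zero]
  · rw [Submodule.codisjoint_iff_exists_add_eq]
    intro v
    obtain ⟨z, hz⟩ := h (Λ v)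
    obtain ⟨a, c, ha, hc, rfl⟩ := (Submodule.codisjoint_iff_exists_add_eq.1 hU.codisjoint) z
    have ha' : Λ (T a) = 0 := ha
    rw [ContinuousLinearMap.comp_apply, map_add, map_add, ha', zero_add] at hz
    refine ⟨v - T c, T c, ?_, ⟨c, hc, rfl⟩, sub_add_cancel _ _⟩
    change Λ (v - T c) = 0
    rw [map_sub, hz, sub_self]

theorem subspaceSplits_of_finiteDimensional [FiniteDimensional ℝ V] (P : Submodule ℝ V) :
    SubspaceSplits P := by
  obtain ⟨C, hC⟩ := Submodule.exists_isCompl P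
  exact ⟨P.closed_of_finiteDimensional, C, C.closed_of_finiteDimensional, hC⟩

end DefiningMap

section Charts

variable {F : Type*} [NormedAddCommGroup F] [NormedSpace ℝ F]
  {Q : Type*} [NormedAddCommGroup Q] [NormedSpace ℝ Q]
  {Y : Type*} [TopologicalSpace Y] [ChartedSpace F Y] {r : WithTop ℕ∞}
  {φ : OpenPartialHomeomorph Y F}

theorem mdifferentiable_of_mem_maximalAtlas (hr : r ≠ 0)
    (hφ : φ ∈ IsManifold.maximalAtlas 𝓘(ℝ, F) r Y) : φ.MDifferentiable 𝓘(ℝ, F) 𝓘(ℝ, F) :=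
  ⟨(contMDiffOn_of_mem_maximalAtlas hφ).mdifferentiableOn hr,
    (contMDiffOn_symm_of_mem_maximalAtlas hφ).mdifferentiableOn hr⟩

theorem hasMFDerivAt_clm_comp_chart (hr : r ≠ 0)
    (hφ : φ ∈ IsManifold.maximalAtlas 𝓘(ℝ, F) r Y) (ℓ : F →L[ℝ] Q) {y : Y} (hy : y ∈ φ.source) :
    HasMFDerivAt 𝓘(ℝ, F) 𝓘(ℝ, Q) (fun y => ℓ (φ y)) y
      (ℓ.comp (mfderiv 𝓘(ℝ, F) 𝓘(ℝ, F) φ y : F →L[ℝ] F)) :=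
  (ℓ.hasFDerivAt.hasMFDerivAt).comp y
    ((mdifferentiable_of_mem_maximalAtlas hr hφ).mdifferentiableAt hy).hasMFDerivAt

theorem surjective_mfderiv_clm_comp_chart (hr : r ≠ 0)
    (hφ : φ ∈ IsManifold.maximalAtlas 𝓘(ℝ, F) r Y) {ℓ : F →L[ℝ] Q} (hℓ : Function.Surjective ℓ)
    {y : Y} (hy : y ∈ φ.source) :
    Function.Surjective (mfderiv 𝓘(ℝ, F) 𝓘(ℝ, Q) (fun y => ℓ (φ y)) y) := by
  rw [(hasMFDerivAt_clm_comp_chart hr hφ ℓ hy).mfderiv]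
  exact hℓ.comp ((mdifferentiable_of_mem_maximalAtlas hr hφ).mfderiv_surjective hy)

/-- Along a curve in `W` the function `ℓ ∘ φ` vanishes, so velocities lie in the kernel. Conversely
a kernel vector is the velocity of a straight line in `G` pulled back by `φ`. -/
theorem tangentSpaceOf_eq_ker (hr : r ≠ 0)
    (hφ : φ ∈ IsManifold.maximalAtlas 𝓘(ℝ, F) r Y) {W : Set Y} {G : Submodule ℝ F}
    (hW : φ.IsImage W (G : Set F)) {ℓ : F →L[ℝ] Q} (hℓ : ∀ v, ℓ v = 0 ↔ v ∈ G) {y : Y}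
    (hy : y ∈ φ.source) (hyW : y ∈ W) :
    tangentSpaceOf (F := F) W y =
      (mfderiv 𝓘(ℝ, F) 𝓘(ℝ, Q) (fun y => ℓ (φ y)) y).toLinearMap.ker := by
  have hΛ := hasMFDerivAt_clm_comp_chart hr hφ ℓ hy
  have hmd := mdifferentiable_of_mem_maximalAtlas hr hφ
  apply le_antisymm
  · refine Submodule.span_le.2 ?_
    rintro v ⟨γ, hγ0, hγW, hγ⟩
    subst hγ0
    have h1 := hΛ.mdifferentiableAt.hasMFDerivAt.comp (0 : ℝ) hγ
    have hev : (fun y => ℓ (φ y)) ∘ γ =ᶠ[𝓝 0] fun _ => 0 := by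
      filter_upwards [hγW, hγ.continuousAt.eventually (φ.open_source.mem_nhds hy)] with t ht hts
      exact (hℓ _).2 ((hW hts).2 ht)
    have h2 : HasMFDerivAt 𝓘(ℝ, ℝ) 𝓘(ℝ, Q) ((fun y => ℓ (φ y)) ∘ γ) 0 _ :=
      (hasMFDerivAt_const (I := 𝓘(ℝ, ℝ)) (I' := 𝓘(ℝ, Q)) (0 : Q) (0 : ℝ)).congr_of_eventuallyEq hev
    have h3 := DFunLike.congr_fun (hasMFDerivAt_unique h1 h2) (1 : ℝ)
    change mfderiv 𝓘(ℝ, F) 𝓘(ℝ, Q) (fun y => ℓ (φ y)) (γ 0) ((1 : ℝ) • v) = 0 at h3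
    rw [one_smul] at h3
    exact h3
  · intro v hv
    rw [hΛ.mfderiv] at hv
    set u : F := mfderiv 𝓘(ℝ, F) 𝓘(ℝ, F) φ y v with hu
    have hu0 : ℓ u = 0 := hv
    have huG : u ∈ G := (hℓ u).1 hu0
    have hyG : φ y ∈ G := (hW hy).2 hyW
    have hc : Continuous fun t : ℝ => φ y + t • u := by fun_prop
    refine Submodule.subset_span ⟨fun t => φ.symm (φ y + t • u), ?_, ?_, ?_⟩
    · simp [φ.left_inv hy]
    · have htgt : ∀ᶠ t in 𝓝 (0 : ℝ), φ y + t • u ∈ φ.target :=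
        hc.continuousAt.eventually (φ.open_target.mem_nhds (by simpa using φ.map_source hy))
      filter_upwards [htgt] with t ht
      exact (hW.symm_apply_mem_iff ht).2 (G.add_mem hyG (G.smul_mem t huG))
    · have hline : HasFDerivAt (fun t : ℝ => φ y + t • u) ((1 : ℝ →L[ℝ] ℝ).smulRight u) 0 := by
        have h1 := ((1 : ℝ →L[ℝ] ℝ).smulRight u).hasFDerivAt (x := (0 : ℝ))
        exact h1.const_add (φ y)
      have hsymm : HasMFDerivAt 𝓘(ℝ, F) 𝓘(ℝ, F) φ.symm (φ y + (0 : ℝ) • u)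
          (mfderiv 𝓘(ℝ, F) 𝓘(ℝ, F) φ.symm (φ y + (0 : ℝ) • u)) :=
        (hmd.symm.mdifferentiableAt (by simpa using φ.map_source hy)).hasMFDerivAt
      have h2 := hsymm.comp (0 : ℝ) (f := fun t : ℝ => φ y + t • u) hline.hasMFDerivAt
      have hv' : mfderiv 𝓘(ℝ, F) 𝓘(ℝ, F) φ.symm (φ y + (0 : ℝ) • u) u = v := by
        have h3 := DFunLike.congr_fun (hmd.symm_comp_deriv hy) v
        have h4 : mfderiv 𝓘(ℝ, F) 𝓘(ℝ, F) φ.symm (φ y) u = v := h3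
        have h5 : φ y + (0 : ℝ) • u = φ y := by simp
        rw [h5]
        exact h4
      refine h2.congr_mfderiv ?_
      ext
      change mfderiv 𝓘(ℝ, F) 𝓘(ℝ, F) φ.symm (φ y + (0 : ℝ) • u) ((1 : ℝ) • u) = (1 : ℝ) • v
      rw [one_smul, one_smul, hv']

end Charts

/-! ### The evaluation map in charts -/

section TransversalAt

variable {F : Type*} [NormedAddCommGroup F] [NormedSpace ℝ F]
  {Q : Type*} [NormedAddCommGroup Q] [NormedSpace ℝ Q]
  {Y : Type*} [TopologicalSpace Y] [ChartedSpace F Y] {r : WithTop ℕ∞}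
  {φ : OpenPartialHomeomorph Y F}
  {E : Type*} [NormedAddCommGroup E] [NormedSpace ℝ E] {H : Type*} [TopologicalSpace H]
  {I : ModelWithCorners ℝ E H} {M : Type*} [TopologicalSpace M] [ChartedSpace H M]

variable (F I) in
/-- The pointwise condition in the definition of transversality. -/
def TransversalAt (f : M → Y) (W : Set Y) (x : M) : Prop :=
  SubspaceSplits ((tangentSpaceOf (F := F) W (f x)).comap (mfderiv I 𝓘(ℝ, F) f x).toLinearMap) ∧
    ∃ C : Submodule ℝ (TangentSpace 𝓘(ℝ, F) (f x)),
      IsClosed (C : Set (TangentSpace 𝓘(ℝ, F) (f x))) ∧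
      C ≤ (mfderiv I 𝓘(ℝ, F) f x).toLinearMap.range ∧
      IsCompl (tangentSpaceOf (F := F) W (f x)) C

theorem mfderiv_clm_comp_chart_comp (hr : r ≠ 0)
    (hφ : φ ∈ IsManifold.maximalAtlas 𝓘(ℝ, F) r Y) (ℓ : F →L[ℝ] Q) {f : M → Y} {x : M}
    (hf : MDifferentiableAt I 𝓘(ℝ, F) f x) (hx : f x ∈ φ.source) :
    (mfderiv I 𝓘(ℝ, Q) (fun x => ℓ (φ (f x))) x : E →L[ℝ] Q) =
      (mfderiv 𝓘(ℝ, F) 𝓘(ℝ, Q) (fun y => ℓ (φ y)) (f x) : F →L[ℝ] Q).comp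
        (mfderiv I 𝓘(ℝ, F) f x : E →L[ℝ] F) :=
  mfderiv_comp x (hasMFDerivAt_clm_comp_chart hr hφ ℓ hx).mdifferentiableAt hf

variable {W : Set Y} {G : Submodule ℝ F} {ℓ : F →L[ℝ] Q} {f : M → Y} {x : M}

theorem TransversalAt.surjective_mfderiv (h : TransversalAt F I f W x) (hr : r ≠ 0)
    (hφ : φ ∈ IsManifold.maximalAtlas 𝓘(ℝ, F) r Y) (hW : φ.IsImage W (G : Set F))
    (hℓ : Function.Surjective ℓ) (hℓG : ∀ v, ℓ v = 0 ↔ v ∈ G)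
    (hf : MDifferentiableAt I 𝓘(ℝ, F) f x) (hx : f x ∈ φ.source) (hxW : f x ∈ W) :
    Function.Surjective (mfderiv I 𝓘(ℝ, Q) (fun x => ℓ (φ (f x))) x) := by
  obtain ⟨-, C, -, hC, hcompl⟩ := h
  rw [tangentSpaceOf_eq_ker hr hφ hW hℓG hx hxW] at hcompl
  have key := mfderiv_clm_comp_chart_comp hr hφ ℓ hf hx
  refine (congrArg (fun T : E →L[ℝ] Q => Function.Surjective T) key).mpr ?_
  exact surjective_comp_of_isCompl_le_range (V := E) (F := F) (Q := Q)
    (T := mfderiv I 𝓘(ℝ, F) f x)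
    (Λ := mfderiv 𝓘(ℝ, F) 𝓘(ℝ, Q) (fun y => ℓ (φ y)) (f x))
    (surjective_mfderiv_clm_comp_chart hr hφ hℓ hx) hC hcompl

theorem transversalAt_of_surjective_mfderiv [FiniteDimensional ℝ E] (hr : r ≠ 0)
    (hφ : φ ∈ IsManifold.maximalAtlas 𝓘(ℝ, F) r Y) (hW : φ.IsImage W (G : Set F))
    (hℓG : ∀ v, ℓ v = 0 ↔ v ∈ G)
    (hf : MDifferentiableAt I 𝓘(ℝ, F) f x) (hx : f x ∈ φ.source) (hxW : f x ∈ W)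
    (h : Function.Surjective (mfderiv I 𝓘(ℝ, Q) (fun x => ℓ (φ (f x))) x)) :
    TransversalAt F I f W x := by
  have key := mfderiv_clm_comp_chart_comp hr hφ ℓ hf hx
  have h := (congrArg (fun T : E →L[ℝ] Q => Function.Surjective T) key).mp h
  refine ⟨subspaceSplits_of_finiteDimensional (V := E) _, ?_⟩
  rw [tangentSpaceOf_eq_ker hr hφ hW hℓG hx hxW]
  exact exists_isCompl_le_range_of_surjective_comp (V := E) (F := F) (Q := Q)
    (T := mfderiv I 𝓘(ℝ, F) f x)
    (Λ := mfderiv 𝓘(ℝ, F) 𝓘(ℝ, Q) (fun y => ℓ (φ y)) (f x)) h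

end TransversalAt

section Evaluation

variable {E : Type*} [NormedAddCommGroup E] {EX : Type*} [NormedAddCommGroup EX]
  {X : Type*} [TopologicalSpace X] {A : TopologicalSpace.Opens E}

open Classical in
/-- A left inverse of the inclusion of an open set. -/
noncomputable def retractOpens (a₀ : A) (e : E) : A := if h : e ∈ A then ⟨e, h⟩ else a₀

theorem retractOpens_coe (a₀ a : A) : retractOpens a₀ (a : E) = a := by
  simp [retractOpens]

/-- A parametrization of `A × X` by an open set of the model space. -/
noncomputable def prodParam (a₀ : A) (χ : OpenPartialHomeomorph X EX) (z : E × EX) : A × X :=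
  (retractOpens a₀ z.1, χ.symm z.2)

/-- Coordinates on `A × X`. -/
noncomputable def prodCoord (χ : OpenPartialHomeomorph X EX) (z : A × X) : E × EX := (z.1, χ z.2)

theorem prodParam_prodCoord (a₀ : A) (χ : OpenPartialHomeomorph X EX) {z : A × X}
    (hz : z.2 ∈ χ.source) :
    prodParam a₀ χ (prodCoord χ z) = z :=
  Prod.ext (retractOpens_coe _ _) (χ.left_inv hz)

variable [NormedSpace ℝ E] [NormedSpace ℝ EX] [ChartedSpace EX X] {n : WithTop ℕ∞} {χ : OpenPartialHomeomorph X EX}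

/-- `A` is open, so the default value `a₀` taken outside it is invisible near a point of `A`. -/
theorem contMDiffAt_retractOpens (n : WithTop ℕ∞) (a₀ a : A) :
    ContMDiffAt 𝓘(ℝ, E) 𝓘(ℝ, E) n (retractOpens a₀) (a : E) := by
  rw [← contMDiffAt_subtype_iff]
  simp only [retractOpens_coe]
  exact contMDiffAt_id

theorem contMDiffAt_prodParam (hχ : χ ∈ IsManifold.maximalAtlas 𝓘(ℝ, EX) n X)
    (a₀ : A) {z : A × X} (hz : z.2 ∈ χ.source) :
    ContMDiffAt 𝓘(ℝ, E × EX) (𝓘(ℝ, E).prod 𝓘(ℝ, EX)) n (prodParam a₀ χ) (prodCoord χ z) := by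
  refine ContMDiffAt.prodMk ?_ ?_
  · exact (contMDiffAt_retractOpens n a₀ z.1).comp (prodCoord χ z) (f := Prod.fst)
      contDiff_fst.contMDiff.contMDiffAt
  · have h1 : ContMDiffAt 𝓘(ℝ, EX) 𝓘(ℝ, EX) n χ.symm (prodCoord χ z).2 :=
      (contMDiffOn_symm_of_mem_maximalAtlas hχ).contMDiffAt
        (χ.open_target.mem_nhds (χ.map_source hz))
    exact h1.comp (prodCoord χ z) (f := Prod.snd) contDiff_snd.contMDiff.contMDiffAt

theorem contMDiffAt_prodCoord (hχ : χ ∈ IsManifold.maximalAtlas 𝓘(ℝ, EX) n X) {z : A × X}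
    (hz : z.2 ∈ χ.source) :
    ContMDiffAt (𝓘(ℝ, E).prod 𝓘(ℝ, EX)) 𝓘(ℝ, E × EX) n (prodCoord χ) z := by
  refine ContMDiffAt.prodMk_space ?_ ?_
  · exact (contMDiff_subtype_val.contMDiffAt).comp z contMDiffAt_fst
  · have h1 : ContMDiffAt 𝓘(ℝ, EX) 𝓘(ℝ, EX) n χ z.2 :=
      (contMDiffOn_of_mem_maximalAtlas hχ).contMDiffAt (χ.open_source.mem_nhds hz)
    exact h1.comp z contMDiffAt_snd

theorem surjective_mfderiv_prodParam (hn : n ≠ 0)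
    (hχ : χ ∈ IsManifold.maximalAtlas 𝓘(ℝ, EX) n X) (a₀ : A) {z : A × X}
    (hz : z.2 ∈ χ.source) :
    Function.Surjective (mfderiv 𝓘(ℝ, E × EX) (𝓘(ℝ, E).prod 𝓘(ℝ, EX)) (prodParam a₀ χ)
      (prodCoord χ z)) := by
  have h1 := ((contMDiffAt_prodParam hχ a₀ hz).mdifferentiableAt hn).hasMFDerivAt.comp z
    ((contMDiffAt_prodCoord hχ hz).mdifferentiableAt hn).hasMFDerivAt
  have hev : prodParam a₀ χ ∘ prodCoord χ =ᶠ[𝓝 z] id := by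
    have : ∀ᶠ y in 𝓝 z, y.2 ∈ χ.source :=
      continuousAt_snd.eventually (χ.open_source.mem_nhds hz)
    exact this.mono fun y hy => prodParam_prodCoord a₀ χ hy
  have h2 := hasMFDerivAt_unique h1 ((hasMFDerivAt_id z).congr_of_eventuallyEq hev)
  exact fun v => ⟨_, DFunLike.congr_fun h2 v⟩

variable {Q : Type*} [NormedAddCommGroup Q] [NormedSpace ℝ Q] {h : A × X → Q}

theorem surjective_fderiv_comp_prodParam (hn : n ≠ 0)
    (hχ : χ ∈ IsManifold.maximalAtlas 𝓘(ℝ, EX) n X) (a₀ : A) {z : A × X}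
    (hz : z.2 ∈ χ.source)
    (hh : MDifferentiableAt (𝓘(ℝ, E).prod 𝓘(ℝ, EX)) 𝓘(ℝ, Q) h z)
    (hsurj : Function.Surjective (mfderiv (𝓘(ℝ, E).prod 𝓘(ℝ, EX)) 𝓘(ℝ, Q) h z)) :
    Function.Surjective (fderiv ℝ (h ∘ prodParam a₀ χ) (prodCoord χ z)) := by
  have hz' := prodParam_prodCoord a₀ χ hz
  rw [← mfderiv_eq_fderiv, mfderiv_comp (prodCoord χ z) (by rwa [hz'])
    ((contMDiffAt_prodParam hχ a₀ hz).mdifferentiableAt hn)]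
  have hsurj' : Function.Surjective (mfderiv (𝓘(ℝ, E).prod 𝓘(ℝ, EX)) 𝓘(ℝ, Q) h
      (prodParam a₀ χ (prodCoord χ z))) := by
    rwa [hz']
  exact hsurj'.comp (surjective_mfderiv_prodParam hn hχ a₀ hz)

theorem surjective_mfderiv_slice (hn : n ≠ 0)
    (hχ : χ ∈ IsManifold.maximalAtlas 𝓘(ℝ, EX) n X) (a₀ : A) {z : A × X}
    (hz : z.2 ∈ χ.source)
    (hh : MDifferentiableAt (𝓘(ℝ, E).prod 𝓘(ℝ, EX)) 𝓘(ℝ, Q) h z)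
    (hsurj : Function.Surjective ((fderiv ℝ (h ∘ prodParam a₀ χ) (prodCoord χ z)).comp
      (ContinuousLinearMap.inr ℝ E EX))) :
    Function.Surjective (mfderiv 𝓘(ℝ, EX) 𝓘(ℝ, Q) (fun x => h (z.1, x)) z.2) := by
  have hz' := prodParam_prodCoord a₀ χ hz
  have hg : MDifferentiableAt 𝓘(ℝ, E × EX) 𝓘(ℝ, Q) (h ∘ prodParam a₀ χ) (prodCoord χ z) :=
    MDifferentiableAt.comp (prodCoord χ z) (by rwa [hz'])
      ((contMDiffAt_prodParam hχ a₀ hz).mdifferentiableAt hn)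
  have hslice : HasFDerivAt (fun u : EX => ((z.1 : E), u)) (ContinuousLinearMap.inr ℝ E EX)
      (χ z.2) := hasFDerivAt_prodMk_right _ _
  have h1 : HasFDerivAt (fun u => (h ∘ prodParam a₀ χ) ((z.1 : E), u))
      ((fderiv ℝ (h ∘ prodParam a₀ χ) (prodCoord χ z)).comp (ContinuousLinearMap.inr ℝ E EX))
      (χ z.2) :=
    hg.differentiableAt.hasFDerivAt.comp (χ z.2) hslice
  have heq : (fun u => (h ∘ prodParam a₀ χ) ((z.1 : E), u)) =
      (fun x => h (z.1, x)) ∘ χ.symm := by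
    funext u
    simp only [Function.comp, prodParam, retractOpens_coe]
  rw [heq] at h1
  have hsymm : MDifferentiableAt 𝓘(ℝ, EX) 𝓘(ℝ, EX) χ.symm
      (χ z.2) :=
    ((contMDiffOn_symm_of_mem_maximalAtlas hχ).contMDiffAt
      (χ.open_target.mem_nhds (χ.map_source hz))).mdifferentiableAt hn
  have hzx : χ.symm (χ z.2) = z.2 := χ.left_inv hz
  have hhs : MDifferentiableAt 𝓘(ℝ, EX) 𝓘(ℝ, Q) (fun x => h (z.1, x)) z.2 :=
    MDifferentiableAt.comp z.2 (g := h) (f := fun x => (z.1, x)) hh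
      (mdifferentiableAt_const.prodMk mdifferentiableAt_id)
  rw [← h1.fderiv, ← mfderiv_eq_fderiv,
    mfderiv_comp (χ z.2) (by rwa [hzx]) hsymm] at hsurj
  have h2 : Function.Surjective (mfderiv 𝓘(ℝ, EX) 𝓘(ℝ, Q) (fun x => h (z.1, x))
      (χ.symm (χ z.2))) :=
    Function.Surjective.of_comp (g := mfderiv 𝓘(ℝ, EX) 𝓘(ℝ, EX) χ.symm
      (χ z.2)) hsurj
  rwa [hzx] at h2

end Evaluation

/-! ### The prevalent transversal density theorem -/

/-- Sard's theorem is applied at a finite order. The additive form of `hr` expresses r > n - q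
without truncated subtraction. -/
theorem exists_pos_nat_le_of_lt_add {r : ℕ∞} {n q : ℕ} (hr0 : 0 < r)
    (hr : (n : ℕ∞) < r + (q : ℕ∞)) : ∃ k : ℕ, 0 < k ∧ (k : ℕ∞) ≤ r ∧ n < k + q := by
  induction r using ENat.recTopCoe with
  | top => exact ⟨n + 1, n.succ_pos, le_top, by omega⟩
  | coe k => exact ⟨k, by exact_mod_cast hr0, le_rfl, by exact_mod_cast hr⟩

theorem separableSpace_of_isSeparable_of_isOpen {E : Type*} [NormedAddCommGroup E]
    [NormedSpace ℝ E] {A : Set E} (hA : TopologicalSpace.IsSeparable A) (hAo : IsOpen A)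
    (hne : A.Nonempty) : TopologicalSpace.SeparableSpace E := by
  rw [← TopologicalSpace.isSeparable_univ_iff]
  have h := hA.span (R := ℝ)
  rwa [Submodule.eq_top_of_nonempty_interior' (Submodule.span ℝ A)
    (hne.mono (interior_maximal Submodule.subset_span hAo)), Submodule.top_coe] at h

theorem isHaarNull_empty {E : Type*} [NormedAddCommGroup E] [MeasurableSpace E]
    [BorelSpace E] : IsHaarNull (∅ : Set E) := by
  refine ⟨∅, Subset.rfl, MeasurableSet.empty, Measure.dirac 0, inferInstance, ?_, ⟨{0},
    isCompact_singleton, ?_⟩, fun x => by simp⟩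
  · exact IsProbabilityMeasure.ne_zero _
  · rw [Measure.dirac_apply' _ (measurableSet_singleton _).compl]
    simp

section TransversalDensity

variable {E : Type*} [NormedAddCommGroup E] [NormedSpace ℝ E]
  {EX : Type*} [NormedAddCommGroup EX] [NormedSpace ℝ EX] [FiniteDimensional ℝ EX]
  {F : Type*} [NormedAddCommGroup F] [NormedSpace ℝ F]
  {X : Type*} [TopologicalSpace X] [ChartedSpace EX X]
  {Y : Type*} [TopologicalSpace Y] [ChartedSpace F Y]

theorem exists_closed_null_slices_of_mem {r : ℕ∞} [IsManifold 𝓘(ℝ, EX) r X]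
    {A : TopologicalSpace.Opens E} {f : A × X → Y}
    (hf : ContMDiff (𝓘(ℝ, E).prod 𝓘(ℝ, EX)) 𝓘(ℝ, F) r f)
    {q : ℕ} {W : Set Y} (hW : IsSubmanifoldOfCodim (F := F) r q W)
    {k : ℕ} (hk : 0 < k) (hkr : (k : ℕ∞) ≤ r) (hdim : finrank ℝ EX < k + q)
    {w : ℕ → E} (hw : Dense (Submodule.span ℝ (range w) : Set E)) {p : A × X} (hp : f p ∈ W)
    (htr : TransversalAt F (𝓘(ℝ, E).prod 𝓘(ℝ, EX)) f W p) :
    ∃ N ∈ 𝓝 p, ∃ S : Set E, IsClosed S ∧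
      (∃ m : ℕ, ∀ e : E, volume {s : Fin m → ℝ | e + ∑ i, s i • w i ∈ S} = 0) ∧
      ∀ z ∈ N, f z ∈ W → ¬ TransversalAt F 𝓘(ℝ, EX) (fun x => f (z.1, x)) W z.2 →
        (z.1 : E) ∈ S := by
  have hr : (r : WithTop ℕ∞) ≠ 0 := by
    have : 0 < r := lt_of_lt_of_le (by exact_mod_cast hk) hkr
    exact_mod_cast this.ne'
  obtain ⟨φ, hφ, hpφ, G, hG, hGfin, hGq, hWG⟩ := hW (f p) hp
  obtain ⟨ℓ, hℓ, hℓG⟩ := exists_clm_ker_eq hG.1 hGq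
  set χ : OpenPartialHomeomorph X EX := chartAt EX p.2 with hχdef
  have hχ : χ ∈ IsManifold.maximalAtlas 𝓘(ℝ, EX) r X := IsManifold.chart_mem_maximalAtlas _
  have hpχ : p.2 ∈ χ.source := mem_chart_source EX p.2
  let h : A × X → (Fin q → ℝ) := fun z => ℓ (φ (f z))
  have hφc : ∀ z, f z ∈ φ.source → ContMDiffAt (𝓘(ℝ, E).prod 𝓘(ℝ, EX)) 𝓘(ℝ, Fin q → ℝ) r h z := by
    intro z hz
    have h1 : ContMDiffAt 𝓘(ℝ, F) 𝓘(ℝ, F) r φ (f z) :=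
      (contMDiffOn_of_mem_maximalAtlas hφ).contMDiffAt (φ.open_source.mem_nhds hz)
    exact ℓ.contDiff.contMDiff.contMDiffAt.comp z (h1.comp z hf.contMDiffAt)
  have hfmd : ∀ z, MDifferentiableAt (𝓘(ℝ, E).prod 𝓘(ℝ, EX)) 𝓘(ℝ, F) f z := fun z =>
    hf.contMDiffAt.mdifferentiableAt hr
  have hpar := prodParam_prodCoord p.1 χ hpχ
  have hg : ContDiffAt ℝ k (h ∘ prodParam p.1 χ) (prodCoord χ p) := by
    have h1 : ContMDiffAt 𝓘(ℝ, E × EX) 𝓘(ℝ, Fin q → ℝ) r (h ∘ prodParam p.1 χ)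
        (prodCoord χ p) := by
      refine ContMDiffAt.comp (prodCoord χ p) ?_ (contMDiffAt_prodParam hχ p.1 hpχ)
      rw [hpar]
      exact hφc p hpφ
    exact h1.contDiffAt.of_le (by exact_mod_cast hkr)
  have hsurj := surjective_fderiv_comp_prodParam hr hχ p.1 hpχ
    ((hφc p hpφ).mdifferentiableAt hr)
    (htr.surjective_mfderiv hr hφ hWG hℓ hℓG (hfmd p) hpφ hp)
  obtain ⟨V, hV, S, hS, hnull, hVS⟩ :=
    exists_closed_null_slices hw hk (by simpa using hdim) hg hsurj
  refine ⟨{z | prodCoord χ z ∈ V ∧ z.2 ∈ χ.source ∧ f z ∈ φ.source}, ?_, S, hS, hnull, ?_⟩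
  · refine Eventually.and ?_ (Eventually.and ?_ ?_)
    · exact (contMDiffAt_prodCoord hχ hpχ).continuousAt.eventually hV
    · exact continuousAt_snd.eventually (χ.open_source.mem_nhds hpχ)
    · exact hf.continuous.continuousAt.eventually (φ.open_source.mem_nhds hpφ)
  · rintro z ⟨hzV, hzχ, hzφ⟩ hzW hns
    have hz' := prodParam_prodCoord p.1 χ hzχ
    refine hVS (prodCoord χ z) hzV ?_ fun hcon => hns ?_
    · simp only [Function.comp, hz']
      exact (hℓG _).2 ((hWG hzφ).2 hzW)
    · refine transversalAt_of_surjective_mfderiv hr hφ hWG hℓG ?_ hzφ hzW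
        (surjective_mfderiv_slice hr hχ p.1 hzχ ((hφc z hzφ).mdifferentiableAt hr) hcon)
      exact MDifferentiableAt.comp z.2 (g := f) (f := fun x => (z.1, x)) (hfmd z)
        (mdifferentiableAt_const.prodMk mdifferentiableAt_id)

end TransversalDensity

theorem theorem4
    {E : Type*} [NormedAddCommGroup E] [NormedSpace ℝ E] [CompleteSpace E]
    [MeasurableSpace E] [BorelSpace E]
    {EX : Type*} [NormedAddCommGroup EX] [NormedSpace ℝ EX] [FiniteDimensional ℝ EX]
    {F : Type*} [NormedAddCommGroup F] [NormedSpace ℝ F] [CompleteSpace F]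
    {X : Type*} [TopologicalSpace X] [ChartedSpace EX X] [SecondCountableTopology X]
    {Y : Type*} [TopologicalSpace Y] [ChartedSpace F Y]
    (r : ℕ∞) [IsManifold 𝓘(ℝ, EX) r X] [IsManifold 𝓘(ℝ, F) r Y]
    (A : TopologicalSpace.Opens E) (hA : TopologicalSpace.IsSeparable (A : Set E))
    (ρ : A → C^r⟮𝓘(ℝ, EX), X; 𝓘(ℝ, F), Y⟯) (hρ : IsCrRepresentation 𝓘(ℝ, E) ρ)
    (n q : ℕ) (hn : Module.finrank ℝ EX = n)
    (W : Set Y) (hW : IsSubmanifoldOfCodim (F := F) r q W)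
    (hr0 : 0 < r) (hr : (n : ℕ∞) < r + (q : ℕ∞))
    (hev : IsTransversalTo (F := F) (𝓘(ℝ, E).prod 𝓘(ℝ, EX)) (evalMap ρ) W) :
    IsGenericIn (A : Set E)
        {a : E | ∃ h : a ∈ A, IsTransversalTo (F := F) 𝓘(ℝ, EX) (ρ ⟨a, h⟩) W} ∧
      IsPrevalentIn (A : Set E)
        {a : E | ∃ h : a ∈ A, IsTransversalTo (F := F) 𝓘(ℝ, EX) (ρ ⟨a, h⟩) W} := by
  set T : Set E := {a : E | ∃ h : a ∈ A, IsTransversalTo (F := F) 𝓘(ℝ, EX) (ρ ⟨a, h⟩) W}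
  have hTA : T ⊆ A := fun a ha => ha.1
  -- Separability passes from `A` to `E` only when `A` is nonempty.
  rcases (A : Set E).eq_empty_or_nonempty with hAe | hAne
  · refine ⟨⟨hTA, fun _ => ∅, fun _ => ⟨isOpen_empty, empty_subset _, by simp [hAe]⟩, ?_⟩, hTA, ?_⟩
    · rw [iInter_const]
      exact empty_subset _
    · rw [hAe, empty_sdiff]
      exact isHaarNull_empty
  obtain ⟨k, hk, hkr, hdim⟩ := exists_pos_nat_le_of_lt_add hr0 hr
  have hEsep : TopologicalSpace.SeparableSpace E :=
    separableSpace_of_isSeparable_of_isOpen hA A.isOpen hAne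
  have hAsep : TopologicalSpace.SeparableSpace A := hA.separableSpace
  have hA2 : SecondCountableTopology A := UniformSpace.secondCountable_of_separable A
  obtain ⟨w, hws, hwd⟩ := exists_summable_norm_dense_span E
  have hloc : ∀ p ∈ {p | evalMap ρ p ∈ W}, ∃ N ∈ 𝓝 p, ∃ S : Set E, IsClosed S ∧
      (∃ m : ℕ, ∀ e : E, volume {s : Fin m → ℝ | e + ∑ i, s i • w i ∈ S} = 0) ∧
      ∀ z ∈ N, evalMap ρ z ∈ W →
        ¬ TransversalAt F 𝓘(ℝ, EX) (fun x => evalMap ρ (z.1, x)) W z.2 → (z.1 : E) ∈ S :=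
    fun p hp => exists_closed_null_slices_of_mem hρ hW hk hkr (hn ▸ hdim) hwd hp (hev.2 p hp)
  choose! N hN S hS hnull hNS using hloc
  -- Second countability gives a countable subcover of an arbitrary subset, so `W` need not be
  -- closed.
  obtain ⟨t, htW, htc, hcov⟩ := TopologicalSpace.countable_cover_nhdsWithin
    fun p hp => mem_nhdsWithin_of_mem_nhds (hN p hp)
  -- Adding ∅ permits an enumeration by ℕ even when `t` is empty.
  obtain ⟨B, hB⟩ := ((htc.image S).insert ∅).exists_eq_range (insert_nonempty _ _)
  have hBprop : ∀ j, IsClosed (B j) ∧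
      ∃ m : ℕ, ∀ e : E, volume {s : Fin m → ℝ | e + ∑ i, s i • w i ∈ B j} = 0 := by
    intro j
    rcases hB.ge (mem_range_self j) with h | ⟨p, hp, h⟩
    · rw [h]
      exact ⟨isClosed_empty, 0, fun e => by simp⟩
    · rw [← h]
      exact ⟨hS p (htW hp), hnull p (htW hp)⟩
  have hbad : (A : Set E) \ T ⊆ ⋃ j, B j := by
    rintro a ⟨haA, haT⟩
    have hex : ∃ x, evalMap ρ (⟨a, haA⟩, x) ∈ W ∧
        ¬ TransversalAt F 𝓘(ℝ, EX) (fun x => evalMap ρ (⟨a, haA⟩, x)) W x := by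
      by_contra! hcon
      refine haT ⟨haA, (ρ ⟨a, haA⟩).contMDiff.of_le ?_, hcon⟩
      exact_mod_cast Order.one_le_iff_pos.2 hr0
    obtain ⟨x, hxW, hx⟩ := hex
    obtain ⟨p, hp, hpx⟩ := mem_iUnion₂.1 (hcov hxW)
    obtain ⟨j, hj⟩ := hB.le (mem_insert_of_mem _ (mem_image_of_mem S hp))
    refine mem_iUnion.2 ⟨j, ?_⟩
    rw [hj]
    exact hNS p (htW hp) _ hpx hxW hx
  refine ⟨⟨hTA, fun j => A \ B j, fun j => ⟨A.isOpen.sdiff (hBprop j).1, sdiff_subset, ?_⟩, ?_⟩,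
    hTA, isHaarNull_of_null_slices hws (fun j => (hBprop j).1.measurableSet)
      (fun j => (hBprop j).2) hbad⟩
  · obtain ⟨m, hm⟩ := (hBprop j).2
    exact subset_closure_diff_of_null_slices A.isOpen hm
  · intro a ha
    by_contra haT
    obtain ⟨j, hj⟩ := mem_iUnion.1 (hbad ⟨(mem_iInter.1 ha 0).1, haT⟩)
    exact (mem_iInter.1 ha j).2 hj
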